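/- There is an absolute constant $C>0$ such that the following holds. Let $H=\sum_{a=1}^{L}H_a$ be a $k$-local stoquastic Hamiltonian on $n$ qubits with $L$ terms: each $H_a$ is Hermitian, acts non-trivially on at most $k$ qubits, and has real non-positive off-diagonal entries in the computational basis. Suppose that $\|H_a\|_{\mathrm{op}}\le J$ for all $a$, and that $H$ has energy gap at least $\Delta>0$, i.e. every eigenvalue of $H$ other than the smallest one exceeds the smallest one by at least $\Delta$. Let $\Pi$ be the orthogonal projection onto the ground subspace of $H$ (the eigenspace of its smallest eigenvalue, possibly degenerate), let $|+\rangle=2^{-n/2}\sum_{x\in\{0,1\}^n}|x\rangle$, and assume $\eta=\sqrt{\langle +|\Pi|+\rangle}>0$. Let $|\psi_0\rangle=\frac1\eta\,\Pi|+\rangle$ and $0<\epsilon\le 1$. Then there is a Deep Boltzmann Machine (DBM) with $n$ visible nodes, whose distribution $p$ on $\{0,1\}^n$ satisfies $$\frac12\sum_{x\in\{0,1\}^n}\Bigl|\,p(x)-|\langle x|\psi_0\rangle|^2\,\Bigr|\le\epsilon ,$$ which has at most $$C\,2^{2k}\,\eta^{-1/2}L^{5/2}J^{3/2}\Delta^{-3/2}\epsilon^{-1/2}\bigl(\log(\eta^{-1}\epsilon^{-1})\bigr)^{3/2}$$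 hidden nodes, and in which each node (visible or hidden) has at most $2^{2k+1}$ connections. Here a DBM is a graph whose nodes carry bits and are split into three layers, visible ($x$), middle ($h$) and deep ($g$), with edges only between visible and middle nodes and between middle and deep nodes, with a real bias on each node and a real weight on each edge. Its energy is $F(x,h,g)=-\sum_i a_ix_i-\sum_j b_jh_j-\sum_l c_lg_l-\sum_{(i,j)}W_{ij}x_ih_j-\sum_{(j,l)}U_{jl}h_jg_l$, the last two sums being over the edges; its distribution is $p(x)=f(x)/\sum_y f(y)$ with $f(x)=\sum_{h,g}e^{-F(x,h,g)}$. The hidden nodes are the middle and the deep nodes, and the number of connections of a node is the number of its edges. -/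

import Mathlib

noncomputable section

/-- Bit strings of length `n`, labelling the computational basis of `n` qubits. -/
abbrev BitString (n : ℕ) : Type := Fin n → Bool

/-- The Hilbert space of `n` qubits, with the Euclidean inner product. -/
abbrev QubitSpace (n : ℕ) : Type := EuclideanSpace ℂ (BitString n)

/-- Operators on `n` qubits, as matrices in the computational basis:
`M x y` is `⟨x|M|y⟩`. -/
abbrev QubitMatrix (n : ℕ) : Type := Matrix (BitString n) (BitString n) ℂ

namespace QubitMatrix

variable {n : ℕ}

/-- `M` acts non-trivially only on the qubits in `S`: it is `A ⊗ 1` with `A` an operator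
on the qubits in `S` and the identity on the remaining ones. -/
def ActsOn (M : QubitMatrix n) (S : Finset (Fin n)) : Prop :=
  ∃ A : Matrix (S → Bool) (S → Bool) ℂ, ∀ x y : BitString n,
    M x y = if ∀ i, i ∉ S → x i = y i then A (fun i => x i) (fun i => y i) else 0

/-- `M` acts non-trivially on at most `k` qubits. -/
def IsLocal (k : ℕ) (M : QubitMatrix n) : Prop :=
  ∃ S : Finset (Fin n), S.card ≤ k ∧ M.ActsOn S

/-- `M` is Hermitian and its off-diagonal entries are real and non-positive. -/
def IsStoquastic (M : QubitMatrix n) : Prop :=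
  M.IsHermitian ∧ ∀ x y : BitString n, x ≠ y → (M x y).im = 0 ∧ (M x y).re ≤ 0

/-- The operator norm of `M` with respect to the Hilbert space norm. -/
def opNorm (M : QubitMatrix n) : ℝ :=
  ‖Matrix.toEuclideanCLM (n := BitString n) (𝕜 := ℂ) M‖

/-- The set of real eigenvalues of `M` (all the eigenvalues, if `M` is Hermitian). -/
def energies (M : QubitMatrix n) : Set ℝ :=
  {E : ℝ | Module.End.HasEigenvalue (Matrix.toEuclideanLin M) (E : ℂ)}

/-- The ground energy: the least eigenvalue of a Hermitian `M`. -/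
def groundEnergy (M : QubitMatrix n) : ℝ := sInf M.energies

/-- The ground subspace: the eigenspace of the least eigenvalue. -/
def groundSpace (M : QubitMatrix n) : Submodule ℂ (QubitSpace n) :=
  Module.End.eigenspace (Matrix.toEuclideanLin M) (M.groundEnergy : ℂ)

/-- `M` has energy gap (at least) `Δ > 0`: every energy other than the ground energy lies
at least `Δ` above it. -/
def HasEnergyGap (M : QubitMatrix n) (Δ : ℝ) : Prop :=
  0 < Δ ∧ ∀ E ∈ M.energies, E ≠ M.groundEnergy → M.groundEnergy + Δ ≤ E

end QubitMatrix

/-- The uniform superposition state `|+⟩` on `n` qubits. -/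
def plusState (n : ℕ) : QubitSpace n :=
  WithLp.toLp 2 fun _ => (((Real.sqrt (2 ^ n))⁻¹ : ℝ) : ℂ)

namespace QubitMatrix

variable {n : ℕ}

/-- `Π |+⟩`, where `Π` is the orthogonal projection onto the ground subspace of `M`. -/
def projectedPlus (M : QubitMatrix n) : QubitSpace n :=
  M.groundSpace.starProjection (plusState n)

/-- `η = √⟨+|Π|+⟩`. -/
def plusOverlap (M : QubitMatrix n) : ℝ :=
  Real.sqrt (inner ℂ (plusState n) M.projectedPlus).re

/-- The ground state `|ψ₀⟩ = (1/η) Π |+⟩`. -/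
def groundState (M : QubitMatrix n) : QubitSpace n :=
  ((M.plusOverlap⁻¹ : ℝ) : ℂ) • M.projectedPlus

/-- The distribution `x ↦ |⟨x|ψ₀⟩|²` of the ground state. -/
def groundDistribution (M : QubitMatrix n) (x : BitString n) : ℝ :=
  ‖M.groundState x‖ ^ 2

end QubitMatrix

/-- Total variation distance of two (real-valued) densities on a finite set. -/
def tvDist {α : Type*} [Fintype α] (p q : α → ℝ) : ℝ :=
  (1 / 2) * ∑ x, |p x - q x|

/-- The numerical value `0` or `1` of a bit. -/
def bitVal (b : Bool) : ℝ := if b then 1 else 0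

/-- A Deep Boltzmann Machine whose visible, middle and deep layers have the node sets `V`, `M`
and `D`. Edges join nodes in consecutive layers only (visible-middle and middle-deep), and every
node carries a real bias and every edge a real weight. -/
structure DBM (V M D : Type*) where
  /-- edges between the visible and the middle layer -/
  edgesVM : Finset (V × M)
  /-- edges between the middle and the deep layer -/
  edgesMD : Finset (M × D)
  /-- biases of the visible nodes -/
  biasV : V → ℝ
  /-- biases of the middle nodes -/
  biasM : M → ℝ
  /-- biases of the deep nodes -/
  biasD : D → ℝ
  /-- weights of the visible-middle edges (only the values on `edgesVM` are used) -/
  weightVM : V → M → ℝ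
  /-- weights of the middle-deep edges (only the values on `edgesMD` are used) -/
  weightMD : M → D → ℝ

namespace DBM

variable {V M D : Type*} [Fintype V] [Fintype M] [Fintype D]

/-- The total energy of a configuration of the nodes. -/
def energy (B : DBM V M D) (x : V → Bool) (h : M → Bool) (g : D → Bool) : ℝ :=
  - ∑ i, B.biasV i * bitVal (x i)
  - ∑ j, B.biasM j * bitVal (h j)
  - ∑ l, B.biasD l * bitVal (g l)
  - ∑ e ∈ B.edgesVM, B.weightVM e.1 e.2 * bitVal (x e.1) * bitVal (h e.2)
  - ∑ e ∈ B.edgesMD, B.weightMD e.1 e.2 * bitVal (h e.1) * bitVal (g e.2)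

variable [DecidableEq V] [DecidableEq M] [DecidableEq D]

/-- The output `f(x)`: the sum of the Boltzmann weights over all values of the hidden nodes. -/
def output (B : DBM V M D) (x : V → Bool) : ℝ :=
  ∑ h : M → Bool, ∑ g : D → Bool, Real.exp (-B.energy x h g)

/-- The distribution `f(x) / ∑ y, f(y)` on the configurations of the visible nodes. -/
def distribution (B : DBM V M D) (x : V → Bool) : ℝ :=
  B.output x / ∑ y : V → Bool, B.output y

end DBM

namespace DBM

variable {V M D : Type*} [DecidableEq V] [DecidableEq M] [DecidableEq D]

/-- The number of connections of a visible node. -/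
def visibleDegree (B : DBM V M D) (i : V) : ℕ :=
  (B.edgesVM.filter fun e => e.1 = i).card

/-- The number of connections of a middle node. -/
def middleDegree (B : DBM V M D) (j : M) : ℕ :=
  (B.edgesVM.filter fun e => e.2 = j).card + (B.edgesMD.filter fun e => e.1 = j).card

/-- The number of connections of a deep node. -/
def deepDegree (B : DBM V M D) (l : D) : ℕ :=
  (B.edgesMD.filter fun e => e.2 = l).card

/-- Every node, visible or hidden, has at most `c` connections. -/
def ConnectionsLE (B : DBM V M D) (c : ℕ) : Prop :=
  (∀ i, B.visibleDegree i ≤ c) ∧ (∀ j, B.middleDegree j ≤ c) ∧ (∀ l, B.deepDegree l ≤ c)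

end DBM

end

/-! The ground state is reached from `|+⟩` by imaginary-time evolution, and a DBM can carry out each
elementary step of that evolution.

Let `T B = 1 + B + B²/2` and `Bₐ = -(t/2) Hₐ`. The palindromic product of the `T Bₐ` agrees with `T
(-tH)` up to terms of third order in `x = tLJ` (`norm_strangProduct_sub_le`). Repeated `N` times it
acts like a power method: components above the gap shrink by `exp (-NtΔ/4)` relative to the ground
component, and the splitting costs a relative error of order `N x³`. Both must be small compared
with `ω = ηε`, because the ground component of `|+⟩` has norm only `η`. The first requirement fixes
the total time `β = Nt ~ log (1/ω)/Δ`; the second then asks for `N ~ (βLJ)^(3/2) ω^(-1/2)`.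

For small `t`, stoquasticity makes each `T Bₐ` entrywise non-negative, and locality makes it a
kernel between bit strings on at most `k` sites. Such a kernel is applied to the output of a DBM by
pushing the old visible nodes on those sites into the deep layer and joining them to fresh visible
nodes through at most `4^k` middle nodes (`DBM.attach_output`). The middle nodes realise every
non-negative kernel in the limit of large weights (`nonneg_kernel_mem_closure`). The argument
therefore runs in the closure of the set of outputs, and a genuine machine is chosen only at the
end.

The resulting output approximates amplitudes. Two copies sharing their visible nodes square it into
probabilities (`DBM.square_output`). The hidden nodes number at most `2 · N · 2L · (4^k + k)`. -/

open Filter Topology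

set_option linter.unusedSectionVars false

/-! ### Partial assignments of bits and sums over hidden bits. -/

/-- Overwrite the entries of `x` at the sites in `S` by `s`. -/
def override {V : Type*} [DecidableEq V] (S : Finset V) (x : V → Bool) (s : S → Bool) :
    V → Bool :=
  fun i => if hi : i ∈ S then s ⟨i, hi⟩ else x i

section override

variable {V : Type*} [DecidableEq V] {S : Finset V} {x : V → Bool} {s : S → Bool}

theorem override_of_mem {i : V} (hi : i ∈ S) : override S x s i = s ⟨i, hi⟩ := by
  simp [override, hi]

theorem override_of_notMem {i : V} (hi : i ∉ S) : override S x s i = x i := by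
  simp [override, hi]

theorem override_coe (i : S) : override S x s i = s i := by
  simp [override]

theorem sum_override [Fintype V] (G : V → Bool → ℝ) :
    ∑ i, G i (override S x s i) =
      ∑ i, (if i ∈ S then 0 else G i (x i)) + ∑ i : S, G i (s i) := by
  have h : ∑ i : S, G i (s i) = ∑ i, if i ∈ S then G i (override S x s i) else 0 := by
    rw [← Finset.sum_filter, Finset.filter_mem_eq_inter, Finset.univ_inter,
      ← Finset.sum_coe_sort S]
    exact Finset.sum_congr rfl fun i _ => by rw [override_coe]
  rw [h, ← Finset.sum_add_distrib]
  refine Finset.sum_congr rfl fun i _ => ?_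
  by_cases hi : i ∈ S <;> simp [hi, override_of_notMem]

/-- Summing over the strings that agree with `x` off `S` is summing over their restrictions
to `S`. -/
theorem sum_agree_off {R : Type*} [AddCommMonoid R] [Fintype V] (F : (V → Bool) → R)
    [∀ z : V → Bool, Decidable (∀ i, i ∉ S → x i = z i)] :
    (∑ z : V → Bool, if ∀ i, i ∉ S → x i = z i then F z else 0) =
      ∑ s : S → Bool, F (override S x s) := by
  classical
  rw [← Finset.sum_filter]
  symm
  refine Finset.sum_bij' (fun s _ => override S x s) (fun z _ => fun i => z i) ?_ ?_ ?_ ?_ ?_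
  · intro s _
    simp only [Finset.mem_filter, Finset.mem_univ, true_and]
    intro i hi
    rw [override_of_notMem hi]
  · simp
  · intro s _
    funext i
    simp [override_coe]
  · intro z hz
    simp only [Finset.mem_filter, Finset.mem_univ, true_and] at hz
    funext i
    by_cases hi : i ∈ S
    · rw [override_of_mem hi]
    · rw [override_of_notMem hi, hz i hi]
  · simp

end override

/-- Nodes that do not interact with each other can be summed out independently, which turns a layer
of middle nodes into a product of factors. -/
theorem sum_boltzmann_bits {P : Type*} [Fintype P] [DecidableEq P] (θ : P → ℝ) :
    ∑ h : P → Bool, Real.exp (∑ p, θ p * bitVal (h p)) = ∏ p, (1 + Real.exp (θ p)) := by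
  have h := Finset.prod_univ_sum (fun _ : P => (Finset.univ : Finset Bool))
    (fun p b => Real.exp (θ p * bitVal b))
  simp only [Fintype.piFinset_univ, ← Real.exp_sum] at h
  rw [← h]
  refine Finset.prod_congr rfl fun p _ => ?_
  simp [bitVal, add_comm]

theorem sum_sumArrow {α β R : Type*} [Fintype α] [Fintype β] [DecidableEq α] [DecidableEq β]
    [AddCommMonoid R] (F : (α ⊕ β → Bool) → R) :
    ∑ h, F h = ∑ h₁ : α → Bool, ∑ h₂ : β → Bool, F (Sum.elim h₁ h₂) := by
  rw [← Fintype.sum_prod_type']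
  exact Fintype.sum_equiv (Equiv.sumArrowEquivProdArrow α β Bool) _ _ fun h => by
    congr 1
    funext i
    cases i <;> rfl

/-! ### Operations on machines: attaching a gadget, squaring the output, renaming hidden nodes. -/

namespace DBM

section energy

variable {V M D : Type*} [Fintype V] [Fintype M] [Fintype D]
  [DecidableEq V] [DecidableEq M] [DecidableEq D]

theorem energy_eq (B : DBM V M D) (x : V → Bool) (h : M → Bool) (g : D → Bool) :
    B.energy x h g =
      - ∑ i, B.biasV i * bitVal (x i)
      - ∑ j, B.biasM j * bitVal (h j)
      - ∑ l, B.biasD l * bitVal (g l)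
      - ∑ j, ∑ i, (if (i, j) ∈ B.edgesVM then
          B.weightVM i j * bitVal (x i) * bitVal (h j) else 0)
      - ∑ j, ∑ l, (if (j, l) ∈ B.edgesMD then
          B.weightMD j l * bitVal (h j) * bitVal (g l) else 0) := by
  unfold energy
  congr 1
  · congr 1
    rw [← Fintype.sum_prod_type_right', ← Finset.sum_filter, Finset.filter_mem_eq_inter,
      Finset.univ_inter]
  · rw [← Fintype.sum_prod_type', ← Finset.sum_filter, Finset.filter_mem_eq_inter,
      Finset.univ_inter]

theorem visibleDegree_eq (B : DBM V M D) (i : V) :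
    B.visibleDegree i = ∑ j, if (i, j) ∈ B.edgesVM then 1 else 0 := by
  rw [visibleDegree, ← Finset.card_filter]
  refine Finset.card_bij' (fun e _ => e.2) (fun j _ => (i, j)) ?_ ?_ ?_ ?_ <;> aesop

theorem middleDegree_eq (B : DBM V M D) (j : M) :
    B.middleDegree j = (∑ i, if (i, j) ∈ B.edgesVM then 1 else 0) +
      ∑ l, if (j, l) ∈ B.edgesMD then 1 else 0 := by
  rw [middleDegree, ← Finset.card_filter, ← Finset.card_filter]
  congr 1
  · refine Finset.card_bij' (fun e _ => e.1) (fun i _ => (i, j)) ?_ ?_ ?_ ?_ <;> aesop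
  · refine Finset.card_bij' (fun e _ => e.2) (fun l _ => (j, l)) ?_ ?_ ?_ ?_ <;> aesop

theorem deepDegree_eq (B : DBM V M D) (l : D) :
    B.deepDegree l = ∑ j, if (j, l) ∈ B.edgesMD then 1 else 0 := by
  rw [deepDegree, ← Finset.card_filter]
  refine Finset.card_bij' (fun e _ => e.1) (fun j _ => (j, l)) ?_ ?_ ?_ ?_ <;> aesop

end energy

section attach

variable {V M D P : Type*} [DecidableEq V]

open Classical in
/-- Apply a gadget on the sites `S`: the visible nodes in `S` become deep nodes, and they are
linked to fresh visible nodes by the middle nodes `P`. -/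
noncomputable def attach [Fintype V] [Fintype M] [Fintype D] [Fintype P]
    (B : DBM V M D) (S : Finset V) (b : P → ℝ) (wV wD : S → P → ℝ) :
    DBM V (M ⊕ P) (D ⊕ S) where
  edgesVM := Finset.univ.filter fun e =>
    Sum.elim (fun j => e.1 ∉ S ∧ (e.1, j) ∈ B.edgesVM) (fun _ => e.1 ∈ S) e.2
  edgesMD := Finset.univ.filter fun e =>
    Sum.elim (fun j => Sum.elim (fun l => (j, l) ∈ B.edgesMD)
      (fun i : S => ((i : V), j) ∈ B.edgesVM) e.2) (fun _ => Sum.elim (fun _ => False)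
      (fun _ => True) e.2) e.1
  biasV i := if i ∈ S then 0 else B.biasV i
  biasM := Sum.elim B.biasM b
  biasD := Sum.elim B.biasD (fun i : S => B.biasV i)
  weightVM i := Sum.elim (fun j => B.weightVM i j)
    (fun p => if hi : i ∈ S then wV ⟨i, hi⟩ p else 0)
  weightMD := Sum.elim (fun j => Sum.elim (fun l => B.weightMD j l) (fun i : S => B.weightVM i j))
    (fun p => Sum.elim (fun _ => 0) (fun i => wD i p))

variable [Fintype V] [Fintype M] [Fintype D] [Fintype P]
  [DecidableEq M] [DecidableEq D] [DecidableEq P]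

/-- The kernel that a gadget of middle nodes induces between two families of bits. -/
noncomputable def gadgetKernel {I P : Type*} [Fintype I] [Fintype P] (b : P → ℝ) (wV wD : I → P → ℝ)
    (y s : I → Bool) : ℝ :=
  ∏ p, (1 + Real.exp (b p + ∑ i, wV i p * bitVal (y i) + ∑ i, wD i p * bitVal (s i)))

/-- The new deep bits `s` play the role of the old visible bits on `S`, so the old machine sees
`override S x s`; the visible bits on `S` enter only through the gadget. -/
theorem attach_energy (B : DBM V M D) (S : Finset V) (b : P → ℝ) (wV wD : S → P → ℝ)
    (x : V → Bool) (h : M → Bool) (h' : P → Bool) (g : D → Bool) (s : S → Bool) :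
    (B.attach S b wV wD).energy x (Sum.elim h h') (Sum.elim g s) =
      B.energy (override S x s) h g -
        ∑ p, (b p + ∑ i : S, wV i p * bitVal (x i) + ∑ i, wD i p * bitVal (s i)) *
          bitVal (h' p) := by
  have hV : ∀ p, ∑ i, (if i ∈ S then (if hi : i ∈ S then wV ⟨i, hi⟩ p else 0) * bitVal (x i)
      * bitVal (h' p) else 0) = (∑ i : S, wV i p * bitVal (x i)) * bitVal (h' p) := by
    intro p
    rw [← Finset.sum_filter, Finset.filter_mem_eq_inter, Finset.univ_inter,
      ← Finset.sum_coe_sort S, Finset.sum_mul]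
    exact Finset.sum_congr rfl fun i _ => by simp
  have h1 : ∀ j, ∑ i, (if (i, j) ∈ B.edgesVM then
        B.weightVM i j * bitVal (override S x s i) * bitVal (h j) else 0) =
      ∑ i, (if i ∉ S ∧ (i, j) ∈ B.edgesVM then
        B.weightVM i j * bitVal (x i) * bitVal (h j) else 0) +
      ∑ i : S, (if ((i : V), j) ∈ B.edgesVM then
        B.weightVM i j * bitVal (h j) * bitVal (s i) else 0) := by
    intro j
    rw [sum_override (fun i c => if (i, j) ∈ B.edgesVM then
        B.weightVM i j * bitVal c * bitVal (h j) else 0)]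
    congr 1
    · refine Finset.sum_congr rfl fun i _ => ?_
      by_cases hi : i ∈ S <;> simp [hi]
    · refine Finset.sum_congr rfl fun i _ => ?_
      split_ifs
      · ring
      · rfl
  rw [energy_eq, energy_eq, sum_override (fun i c => B.biasV i * bitVal c)]
  simp only [h1]
  simp only [attach, Fintype.sum_sum_type, Sum.elim_inl, Sum.elim_inr, Finset.mem_filter,
    Finset.mem_univ, true_and, if_true, if_false, hV, Finset.sum_add_distrib, add_mul,
    Finset.sum_const_zero, ite_mul, zero_mul, Finset.sum_mul]
  have h2 : ∀ p (i : S), wD i p * bitVal (h' p) * bitVal (s i)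
      = wD i p * bitVal (s i) * bitVal (h' p) := fun p i => by ring
  simp only [h2]
  ring

/-- Summing out the gadget's middle nodes yields the kernel, and summing out the new deep nodes is
then the matrix-vector product with it. -/
theorem attach_output (B : DBM V M D) (S : Finset V) (b : P → ℝ) (wV wD : S → P → ℝ)
    (x : V → Bool) :
    (B.attach S b wV wD).output x =
      ∑ s : S → Bool, gadgetKernel b wV wD (fun i => x i) s * B.output (override S x s) := by
  have key : ∀ (h : M → Bool) (h' : P → Bool) (g : D → Bool) (s : S → Bool),
      Real.exp (-(B.attach S b wV wD).energy x (Sum.elim h h') (Sum.elim g s)) =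
        Real.exp (∑ p, (b p + ∑ i : S, wV i p * bitVal (x i) + ∑ i, wD i p * bitVal (s i)) *
          bitVal (h' p)) * Real.exp (-B.energy (override S x s) h g) := by
    intro h h' g s
    rw [attach_energy, ← Real.exp_add]
    congr 1
    ring
  rw [output, sum_sumArrow]
  simp only [sum_sumArrow (α := D), key]
  have h3 : ∀ s : S → Bool, gadgetKernel b wV wD (fun i => x i) s * B.output (override S x s) =
      ∑ h : M → Bool, ∑ h' : P → Bool, ∑ g : D → Bool,
        Real.exp (∑ p, (b p + ∑ i : S, wV i p * bitVal (x i) + ∑ i, wD i p * bitVal (s i)) *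
          bitVal (h' p)) * Real.exp (-B.energy (override S x s) h g) := by
    intro s
    rw [gadgetKernel, ← sum_boltzmann_bits, output, Finset.sum_mul_sum, Finset.sum_comm]
    simp only [Finset.mul_sum]
  simp only [h3]
  conv_rhs => rw [Finset.sum_comm]
  refine Finset.sum_congr rfl fun h _ => ?_
  conv_rhs => rw [Finset.sum_comm]
  refine Finset.sum_congr rfl fun h' _ => ?_
  rw [Finset.sum_comm]

/-- Degrees do not accumulate under repeated attachment: a visible node in `S` is fresh, and the
node it replaces becomes deep and receives no further edges. -/
theorem attach_visibleDegree (B : DBM V M D) (S : Finset V) (b : P → ℝ) (wV wD : S → P → ℝ)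
    (i : V) : (B.attach S b wV wD).visibleDegree i =
      if i ∈ S then Fintype.card P else B.visibleDegree i := by
  rw [visibleDegree_eq, visibleDegree_eq, Fintype.sum_sum_type]
  by_cases hi : i ∈ S <;> simp [attach, hi]

theorem attach_middleDegree_inl (B : DBM V M D) (S : Finset V) (b : P → ℝ)
    (wV wD : S → P → ℝ) (j : M) :
    (B.attach S b wV wD).middleDegree (Sum.inl j) = B.middleDegree j := by
  rw [middleDegree_eq, middleDegree_eq, Fintype.sum_sum_type]
  have h : (∑ i, if (i, j) ∈ B.edgesVM then 1 else 0) =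
      (∑ i, if i ∉ S ∧ (i, j) ∈ B.edgesVM then 1 else 0) +
        ∑ i : S, if ((i : V), j) ∈ B.edgesVM then 1 else 0 := by
    rw [Finset.sum_coe_sort S (fun i => if (i, j) ∈ B.edgesVM then 1 else 0),
      ← Finset.univ_inter S, ← Finset.filter_mem_eq_inter, Finset.sum_filter,
      ← Finset.sum_add_distrib]
    refine Finset.sum_congr rfl fun i _ => ?_
    by_cases hi : i ∈ S <;> simp [hi]
  rw [h]
  simp only [attach, Finset.mem_filter, Finset.mem_univ, true_and, Sum.elim_inl, Sum.elim_inr]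
  ring

theorem attach_middleDegree_inr (B : DBM V M D) (S : Finset V) (b : P → ℝ)
    (wV wD : S → P → ℝ) (p : P) :
    (B.attach S b wV wD).middleDegree (Sum.inr p) = 2 * S.card := by
  rw [middleDegree_eq, Fintype.sum_sum_type]
  simp [attach, two_mul]

theorem attach_deepDegree_inl (B : DBM V M D) (S : Finset V) (b : P → ℝ)
    (wV wD : S → P → ℝ) (l : D) :
    (B.attach S b wV wD).deepDegree (Sum.inl l) = B.deepDegree l := by
  rw [deepDegree_eq, deepDegree_eq, Fintype.sum_sum_type]
  simp [attach]

theorem attach_deepDegree_inr (B : DBM V M D) (S : Finset V) (b : P → ℝ)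
    (wV wD : S → P → ℝ) (i : S) :
    (B.attach S b wV wD).deepDegree (Sum.inr i) = B.visibleDegree i + Fintype.card P := by
  rw [deepDegree_eq, visibleDegree_eq, Fintype.sum_sum_type]
  simp [attach]

end attach

section square

variable {V M D : Type*} [DecidableEq V] [Fintype V] [Fintype M] [Fintype D]
  [DecidableEq M] [DecidableEq D]

/-- Two copies of a machine with the same visible nodes. -/
noncomputable def square (B : DBM V M D) : DBM V (M ⊕ M) (D ⊕ D) where
  edgesVM := Finset.univ.filter fun e => (e.1, Sum.elim id id e.2) ∈ B.edgesVM
  edgesMD := Finset.univ.filter fun e =>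
    (Sum.elim id id e.1, Sum.elim id id e.2) ∈ B.edgesMD ∧ e.1.isLeft = e.2.isLeft
  biasV i := 2 * B.biasV i
  biasM := Sum.elim B.biasM B.biasM
  biasD := Sum.elim B.biasD B.biasD
  weightVM i := Sum.elim (B.weightVM i) (B.weightVM i)
  weightMD j l := B.weightMD (Sum.elim id id j) (Sum.elim id id l)

theorem square_energy (B : DBM V M D) (x : V → Bool) (h h' : M → Bool) (g g' : D → Bool) :
    B.square.energy x (Sum.elim h h') (Sum.elim g g') = B.energy x h g + B.energy x h' g' := by
  rw [energy_eq, energy_eq, energy_eq]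
  simp [square, Fintype.sum_sum_type, mul_assoc, ← Finset.mul_sum]
  ring_nf

theorem square_output (B : DBM V M D) (x : V → Bool) :
    B.square.output x = B.output x ^ 2 := by
  rw [output, sum_sumArrow]
  simp only [sum_sumArrow (α := D), square_energy, neg_add, Real.exp_add]
  rw [sq, output, Finset.sum_mul_sum]
  refine Finset.sum_congr rfl fun h _ => Finset.sum_congr rfl fun h' _ => ?_
  rw [Finset.sum_mul_sum]

theorem square_visibleDegree (B : DBM V M D) (i : V) :
    B.square.visibleDegree i = 2 * B.visibleDegree i := by
  rw [visibleDegree_eq, visibleDegree_eq, Fintype.sum_sum_type]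
  simp [square, two_mul]

theorem square_middleDegree (B : DBM V M D) (j : M ⊕ M) :
    B.square.middleDegree j = B.middleDegree (Sum.elim id id j) := by
  rw [middleDegree_eq, middleDegree_eq, Fintype.sum_sum_type]
  cases j <;> simp [square, -Finset.sum_boole] <;> congr!

theorem square_deepDegree (B : DBM V M D) (l : D ⊕ D) :
    B.square.deepDegree l = B.deepDegree (Sum.elim id id l) := by
  rw [deepDegree_eq, deepDegree_eq, Fintype.sum_sum_type]
  cases l <;> simp [square, -Finset.sum_boole] <;> congr!

end square

section reindex

variable {V M D M' D' : Type*} [DecidableEq V] [Fintype V] [Fintype M] [Fintype D]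
  [DecidableEq M] [DecidableEq D] [Fintype M'] [Fintype D'] [DecidableEq M'] [DecidableEq D']

/-- Rename the hidden nodes. -/
noncomputable def reindex (B : DBM V M D) (eM : M' ≃ M) (eD : D' ≃ D) : DBM V M' D' where
  edgesVM := Finset.univ.filter fun e => (e.1, eM e.2) ∈ B.edgesVM
  edgesMD := Finset.univ.filter fun e => (eM e.1, eD e.2) ∈ B.edgesMD
  biasV := B.biasV
  biasM j := B.biasM (eM j)
  biasD l := B.biasD (eD l)
  weightVM i j := B.weightVM i (eM j)
  weightMD j l := B.weightMD (eM j) (eD l)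

theorem reindex_energy (B : DBM V M D) (eM : M' ≃ M) (eD : D' ≃ D) (x : V → Bool)
    (h : M → Bool) (g : D → Bool) :
    (B.reindex eM eD).energy x (h ∘ eM) (g ∘ eD) = B.energy x h g := by
  rw [energy_eq, energy_eq]
  simp only [reindex, Finset.mem_filter, Finset.mem_univ, true_and, Function.comp]
  congr 1
  · congr 1
    · congr 1
      · congr 1
        exact Equiv.sum_comp eM (fun j => B.biasM j * bitVal (h j))
      · exact Equiv.sum_comp eD (fun l => B.biasD l * bitVal (g l))
    · exact Equiv.sum_comp eM (fun j => ∑ i, (if (i, j) ∈ B.edgesVM then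
          B.weightVM i j * bitVal (x i) * bitVal (h j) else 0))
  · rw [← Equiv.sum_comp eM]
    refine Finset.sum_congr rfl fun j _ => ?_
    exact Equiv.sum_comp eD (fun l => (if (eM j, l) ∈ B.edgesMD then
          B.weightMD (eM j) l * bitVal (h (eM j)) * bitVal (g l) else 0))

theorem reindex_output (B : DBM V M D) (eM : M' ≃ M) (eD : D' ≃ D) (x : V → Bool) :
    (B.reindex eM eD).output x = B.output x := by
  rw [output, output, ← Equiv.sum_comp (Equiv.arrowCongr eM.symm (Equiv.refl Bool))]
  refine Finset.sum_congr rfl fun h _ => ?_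
  rw [← Equiv.sum_comp (Equiv.arrowCongr eD.symm (Equiv.refl Bool))]
  refine Finset.sum_congr rfl fun g _ => ?_
  rw [← reindex_energy B eM eD x h g]
  rfl

theorem reindex_visibleDegree (B : DBM V M D) (eM : M' ≃ M) (eD : D' ≃ D) (i : V) :
    (B.reindex eM eD).visibleDegree i = B.visibleDegree i := by
  rw [visibleDegree_eq, visibleDegree_eq, ← Equiv.sum_comp eM]
  simp [reindex]

theorem reindex_middleDegree (B : DBM V M D) (eM : M' ≃ M) (eD : D' ≃ D) (j : M') :
    (B.reindex eM eD).middleDegree j = B.middleDegree (eM j) := by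
  rw [middleDegree_eq, middleDegree_eq, ← Equiv.sum_comp eD]
  simp [reindex]

theorem reindex_deepDegree (B : DBM V M D) (eM : M' ≃ M) (eD : D' ≃ D) (l : D') :
    (B.reindex eM eD).deepDegree l = B.deepDegree (eD l) := by
  rw [deepDegree_eq, deepDegree_eq, ← Equiv.sum_comp eM]
  simp [reindex]

end reindex

end DBM

/-! ### Approximating arbitrary non-negative kernels by gadgets. -/

section gadget

variable {I : Type} [Fintype I] [DecidableEq I]

/-- The kernels between two families of bits that a scaled gadget with `4 ^ |I|` middle nodes
can produce. -/
def gadgetKernels (I : Type) [Fintype I] [DecidableEq I] : Set ((I → Bool) → (I → Bool) → ℝ) :=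
  {κ | ∃ (b : (I → Bool) × (I → Bool) → ℝ) (wV wD : I → (I → Bool) × (I → Bool) → ℝ) (c : ℝ),
    0 < c ∧ κ = fun y s => c * DBM.gadgetKernel b wV wD y s}

/-- The number of sites at which two bit strings differ, as an affine function of the second
one. -/
theorem sum_bit_mismatch (u v : I → Bool) :
    ∑ i, bitVal (u i) + ∑ i, (1 - 2 * bitVal (u i)) * bitVal (v i) =
      ((Finset.univ.filter fun i => u i ≠ v i).card : ℝ) := by
  rw [← Finset.sum_add_distrib, Finset.card_filter]
  push_cast
  refine Finset.sum_congr rfl fun i _ => ?_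
  cases u i <;> cases v i <;> norm_num [bitVal]

theorem tendsto_selector {b : ℝ} {d : ℕ} (hd : 0 < d) :
    Tendsto (fun t : ℕ => 1 + Real.exp (b - t * d)) atTop (𝓝 1) := by
  have h1 : Tendsto (fun t : ℕ => b - (t : ℝ) * d) atTop atBot := by
    have h2 : Tendsto (fun t : ℕ => (t : ℝ) * d) atTop atTop :=
      tendsto_natCast_atTop_atTop.atTop_mul_const (by exact_mod_cast hd)
    simpa [sub_eq_add_neg] using tendsto_atBot_add_const_left atTop b
      (tendsto_neg_atTop_atBot.comp h2)
  simpa using (Real.tendsto_exp_atBot.comp h1).const_add 1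

/-- There is one middle node per pair `p` of strings. Its activation is `log (lam p)` minus `t`
times the Hamming distance from `p` to `(y, s)`, so as `t → ∞` its factor tends to `1 + lam p` when
`p = (y, s)` and to `1` otherwise. -/
theorem pos_kernel_mem_closure (A : (I → Bool) → (I → Bool) → ℝ) (hA : ∀ y s, 0 < A y s) :
    A ∈ closure (gadgetKernels I) := by
  obtain ⟨q, -, hq⟩ := Finset.exists_min_image (Finset.univ : Finset ((I → Bool) × (I → Bool)))
    (fun q => A q.1 q.2) Finset.univ_nonempty
  -- Half the minimum of `A`, so that `A / c - 1` is strictly positive and has a logarithm to use as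
  -- a bias.
  set c := A q.1 q.2 / 2 with hc
  have hc0 : 0 < c := half_pos (hA _ _)
  have hlt : ∀ y s, c < A y s := fun y s =>
    (half_lt_self (hA _ _)).trans_le (hq (y, s) (Finset.mem_univ _))
  set lam : (I → Bool) × (I → Bool) → ℝ := fun p => A p.1 p.2 / c - 1 with hlam
  have hlam0 : ∀ p, 0 < lam p := fun p => by
    simp only [hlam, sub_pos]
    rw [lt_div_iff₀ hc0, one_mul]
    exact hlt _ _
  let dist : (I → Bool) × (I → Bool) → (I → Bool) → (I → Bool) → ℕ := fun p y s =>
    (Finset.univ.filter fun i => p.1 i ≠ y i).card +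
      (Finset.univ.filter fun i => p.2 i ≠ s i).card
  let κ : ℕ → (I → Bool) → (I → Bool) → ℝ := fun t y s =>
    c * DBM.gadgetKernel
      (fun p => Real.log (lam p) - t * (∑ i, bitVal (p.1 i) + ∑ i, bitVal (p.2 i)))
      (fun i p => - t * (1 - 2 * bitVal (p.1 i))) (fun i p => - t * (1 - 2 * bitVal (p.2 i))) y s
  have hκ : ∀ t y s, κ t y s = c * ∏ p, (1 + Real.exp (Real.log (lam p) - t * dist p y s)) := by
    intro t y s
    simp only [κ, DBM.gadgetKernel, dist]
    congr 1
    refine Finset.prod_congr rfl fun p _ => ?_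
    push_cast
    rw [← sum_bit_mismatch, ← sum_bit_mismatch]
    simp only [mul_assoc, ← Finset.mul_sum]
    congr 2
    ring
  refine mem_closure_of_tendsto (f := κ) (b := atTop) ?_ (Eventually.of_forall fun t =>
    ⟨_, _, _, c, hc0, rfl⟩)
  rw [tendsto_pi_nhds]
  intro y
  rw [tendsto_pi_nhds]
  intro s
  simp only [hκ]
  have hlim : c * ∏ p, (1 + if p = (y, s) then lam p else 0) = A y s := by
    rw [Finset.prod_eq_single (y, s) (fun p _ hp => by simp [hp]) (by simp), if_pos rfl]
    simp only [hlam]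
    field_simp
    ring
  rw [← hlim]
  refine Tendsto.const_mul c (tendsto_finsetProd _ fun p _ => ?_)
  by_cases hp : p = (y, s)
  · subst hp
    have h0 : dist (y, s) y s = 0 := by simp [dist]
    simp only [h0, Nat.cast_zero, mul_zero, sub_zero, if_true, Real.exp_log (hlam0 _)]
    exact tendsto_const_nhds
  · have hd : 0 < dist p y s := by
      rw [Nat.pos_iff_ne_zero]
      intro h0
      apply hp
      simp only [dist, add_eq_zero, Finset.card_eq_zero, Finset.filter_eq_empty_iff,
        Finset.mem_univ, true_implies, not_not] at h0
      exact Prod.ext (funext fun i => @h0.1 i) (funext fun i => @h0.2 i)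
    simpa [hp] using tendsto_selector (b := Real.log (lam p)) hd

theorem nonneg_kernel_mem_closure (A : (I → Bool) → (I → Bool) → ℝ) (hA : ∀ y s, 0 ≤ A y s) :
    A ∈ closure (gadgetKernels I) := by
  rw [← closure_closure]
  refine mem_closure_of_tendsto (f := fun (t : ℕ) y s => A y s + 1 / ((t : ℝ) + 1)) (b := atTop)
    ?_ (Eventually.of_forall fun t => pos_kernel_mem_closure _ fun y s =>
      add_pos_of_nonneg_of_pos (hA y s) (by positivity))
  simp only [tendsto_pi_nhds]
  intro y s
  simpa using (tendsto_one_div_add_atTop_nhds_zero_nat (𝕜 := ℝ)).const_add (A y s)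

end gadget

/-! ### Outputs of bounded machines and their limits. -/

/-- The multiples of outputs of machines with at most `h` hidden nodes, at most `2 ^ (2 * k)`
connections at each visible node and at most `2 ^ (2 * k + 1)` at each hidden node. -/
def dbmOutputs (n k h : ℕ) : Set (BitString n → ℝ) :=
  {f | ∃ (M D : Type) (_ : Fintype M) (_ : Fintype D) (_ : DecidableEq M) (_ : DecidableEq D)
    (B : DBM (Fin n) M D) (c : ℝ), 0 < c ∧ Fintype.card M + Fintype.card D ≤ h ∧
      (∀ i, B.visibleDegree i ≤ 2 ^ (2 * k)) ∧ (∀ j, B.middleDegree j ≤ 2 ^ (2 * k + 1)) ∧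
      (∀ l, B.deepDegree l ≤ 2 ^ (2 * k + 1)) ∧ f = fun x => c * B.output x}

/-- A machine without hidden nodes, biases and edges. -/
def trivialDBM (V M D : Type*) : DBM V M D where
  edgesVM := ∅
  edgesMD := ∅
  biasV _ := 0
  biasM _ := 0
  biasD _ := 0
  weightVM _ _ := 0
  weightMD _ _ := 0

theorem trivialDBM_output (n : ℕ) (x : BitString n) :
    (trivialDBM (Fin n) (Fin 0) (Fin 0)).output x = 1 := by
  simp [DBM.output, DBM.energy, trivialDBM]

theorem const_mem_dbmOutputs (n k : ℕ) {c : ℝ} (hc : 0 < c) :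
    (fun _ => c) ∈ dbmOutputs n k 0 := by
  refine ⟨Fin 0, Fin 0, inferInstance, inferInstance, inferInstance, inferInstance,
    trivialDBM _ _ _, c, hc, by simp, fun i => ?_, fun j => j.elim0, fun l => l.elim0, ?_⟩
  · simp [DBM.visibleDegree, trivialDBM]
  · simp [trivialDBM_output]

theorem gadget_mem_dbmOutputs {n k h : ℕ} {S : Finset (Fin n)} (hS : S.card ≤ k)
    {κ : (S → Bool) → (S → Bool) → ℝ} (hκ : κ ∈ gadgetKernels S) {f : BitString n → ℝ}
    (hf : f ∈ dbmOutputs n k h) :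
    (fun x => ∑ s : S → Bool, κ (fun i => x i) s * f (override S x s)) ∈
      dbmOutputs n k (h + (2 ^ (2 * k) + k)) := by
  obtain ⟨b, wV, wD, c, hc, rfl⟩ := hκ
  obtain ⟨M, D, _, _, _, _, B, c', hc', hcard, hv, hm, hd, rfl⟩ := hf
  have hP : Fintype.card ((S → Bool) × (S → Bool)) ≤ 2 ^ (2 * k) := by
    simp only [Fintype.card_prod, Fintype.card_fun, Fintype.card_bool, Fintype.card_coe]
    rw [← pow_add, ← two_mul]
    exact Nat.pow_le_pow_right (by norm_num) (by omega)
  refine ⟨M ⊕ ((S → Bool) × (S → Bool)), D ⊕ S, inferInstance, inferInstance, inferInstance,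
    inferInstance, B.attach S b wV wD, c * c', mul_pos hc hc', ?_, ?_, ?_, ?_, ?_⟩
  · rw [Fintype.card_sum, Fintype.card_sum, Fintype.card_coe]
    omega
  · intro i
    rw [DBM.attach_visibleDegree]
    split_ifs
    · exact hP
    · exact hv i
  · rintro (j | p)
    · rw [DBM.attach_middleDegree_inl]
      exact hm j
    · rw [DBM.attach_middleDegree_inr]
      have : 2 * k < 2 ^ (2 * k) := Nat.lt_two_pow_self
      rw [pow_succ]
      omega
  · rintro (l | i)
    · rw [DBM.attach_deepDegree_inl]
      exact hd l
    -- A new deep node keeps its at most `4^k` edges as a visible node and gains at most `4^k` from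
    -- the gadget; this gives `2^(2k+1)`.
    · rw [DBM.attach_deepDegree_inr, pow_succ]
      have := hv i
      omega
  · funext x
    rw [DBM.attach_output, Finset.mul_sum]
    exact Finset.sum_congr rfl fun s _ => by ring

/-- Kernel application is jointly continuous in the kernel and the vector, so limits of both may be
taken at once and the node count is unaffected. -/
theorem kernel_mem_closure_dbmOutputs {n k h : ℕ} {S : Finset (Fin n)} (hS : S.card ≤ k)
    {A : (S → Bool) → (S → Bool) → ℝ} (hA : ∀ y s, 0 ≤ A y s) {f : BitString n → ℝ}
    (hf : f ∈ closure (dbmOutputs n k h)) :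
    (fun x => ∑ s : S → Bool, A (fun i => x i) s * f (override S x s)) ∈
      closure (dbmOutputs n k (h + (2 ^ (2 * k) + k))) := by
  refine map_mem_closure₂
    (f := fun (κ : (S → Bool) → (S → Bool) → ℝ) (f : BitString n → ℝ) (x : BitString n) =>
      ∑ s : S → Bool, κ (fun i => x i) s * f (override S x s))
    ?_ (nonneg_kernel_mem_closure A hA) hf fun κ hκ g hg => gadget_mem_dbmOutputs hS hκ hg
  fun_prop

/-- Squaring doubles the visible degrees, which is why they were held to `2^(2k)`; the other degrees
are unchanged. Normalisation removes the unknown scale `c`. -/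
theorem exists_dbm_of_mem_dbmOutputs {n k h : ℕ} {f : BitString n → ℝ}
    (hf : f ∈ dbmOutputs n k h) :
    ∃ (m d : ℕ) (B : DBM (Fin n) (Fin m) (Fin d)),
      m + d ≤ 2 * h ∧ B.ConnectionsLE (2 ^ (2 * k + 1)) ∧
      B.distribution = fun x => f x ^ 2 / ∑ y, f y ^ 2 := by
  obtain ⟨M, D, _, _, _, _, B, c, hc, hcard, hv, hm, hd, rfl⟩ := hf
  let eM := (Fintype.equivFin (M ⊕ M)).symm
  let eD := (Fintype.equivFin (D ⊕ D)).symm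
  refine ⟨_, _, B.square.reindex eM eD, ?_, ⟨fun i => ?_, fun j => ?_, fun l => ?_⟩, ?_⟩
  · rw [Fintype.card_sum, Fintype.card_sum]
    omega
  · rw [DBM.reindex_visibleDegree, DBM.square_visibleDegree, pow_succ, mul_comm]
    exact Nat.mul_le_mul_right 2 (hv i)
  · rw [DBM.reindex_middleDegree, DBM.square_middleDegree]
    exact hm _
  · rw [DBM.reindex_deepDegree, DBM.square_deepDegree]
    exact hd _
  · funext x
    simp only [DBM.distribution, DBM.reindex_output, DBM.square_output, mul_pow, ← Finset.mul_sum]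
    rw [mul_div_mul_left _ _ (by positivity)]

/-- The normalised square is continuous where `∑ f² ≠ 0`, so the strict inequality survives at a
nearby genuine output. -/
theorem exists_dbm_of_mem_closure {n k h : ℕ} {f q : BitString n → ℝ} {ε : ℝ}
    (hf : f ∈ closure (dbmOutputs n k h)) (hf0 : 0 < ∑ y, f y ^ 2)
    (hq : tvDist (fun x => f x ^ 2 / ∑ y, f y ^ 2) q < ε) :
    ∃ (m d : ℕ) (B : DBM (Fin n) (Fin m) (Fin d)),
      m + d ≤ 2 * h ∧ B.ConnectionsLE (2 ^ (2 * k + 1)) ∧ tvDist B.distribution q ≤ ε := by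
  have hcont : ContinuousAt (fun g : BitString n → ℝ =>
      tvDist (fun x => g x ^ 2 / ∑ y, g y ^ 2) q) f := by
    unfold tvDist
    refine continuousAt_const.mul (tendsto_finsetSum _ fun x _ => ?_)
    refine ContinuousAt.abs (ContinuousAt.sub (ContinuousAt.div ?_ ?_ hf0.ne') continuousAt_const)
    · exact ((continuous_apply x).pow 2).continuousAt
    · exact tendsto_finsetSum _ fun y _ => ((continuous_apply y).pow 2).continuousAt
  obtain ⟨g, hg, hgmem⟩ := mem_closure_iff_nhds.mp hf _ (hcont.eventually_lt_const hq)
  obtain ⟨m, d, B, hmd, hB, hdist⟩ := exists_dbm_of_mem_dbmOutputs hgmem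
  exact ⟨m, d, B, hmd, hB, by rw [hdist]; exact le_of_lt hg⟩

/-- The vector `v` has real amplitudes that are limits of outputs of bounded machines. -/
def IsDBMLimit {n : ℕ} (k h : ℕ) (v : QubitSpace n) : Prop :=
  ∃ f ∈ closure (dbmOutputs n k h), ∀ x, v x = (f x : ℂ)

/-! ### Local operators and their action on machine limits. -/

namespace QubitMatrix

variable {n : ℕ} {S : Finset (Fin n)} {M N : QubitMatrix n}

/-- All the entries of `M` are real and non-negative. -/
def EntrywiseNonneg (M : QubitMatrix n) : Prop :=
  ∀ x y, (M x y).im = 0 ∧ 0 ≤ (M x y).re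

theorem ActsOn.one : (1 : QubitMatrix n).ActsOn S := by
  refine ⟨1, fun x y => ?_⟩
  simp only [Matrix.one_apply]
  by_cases h : ∀ i, i ∉ S → x i = y i
  · rw [if_pos h]
    congr 1
    refine propext ⟨fun hxy => by rw [hxy], fun hxy => funext fun i => ?_⟩
    by_cases hi : i ∈ S
    · exact congrFun hxy ⟨i, hi⟩
    · exact h i hi
  · rw [if_neg h, if_neg]
    rintro rfl
    exact h fun _ _ => rfl

theorem ActsOn.add (hM : M.ActsOn S) (hN : N.ActsOn S) : (M + N).ActsOn S := by
  obtain ⟨A, hA⟩ := hM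
  obtain ⟨A', hA'⟩ := hN
  refine ⟨A + A', fun x y => ?_⟩
  rw [Matrix.add_apply, hA, hA']
  split_ifs <;> simp

theorem ActsOn.smul (c : ℂ) (hM : M.ActsOn S) : (c • M).ActsOn S := by
  obtain ⟨A, hA⟩ := hM
  refine ⟨c • A, fun x y => ?_⟩
  rw [Matrix.smul_apply, hA]
  split_ifs <;> simp

theorem ActsOn.sum_mul {A : Matrix (S → Bool) (S → Bool) ℂ}
    (hA : ∀ x y : BitString n,
      M x y = if ∀ i, i ∉ S → x i = y i then A (fun i => x i) (fun i => y i) else 0)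
    (F : BitString n → ℂ) (x : BitString n) :
    ∑ z, M x z * F z = ∑ s : S → Bool, A (fun i => x i) s * F (override S x s) := by
  have h := sum_agree_off (S := S) (x := x)
    (fun z => A (fun i => x i) (fun i => z i) * F z)
  simp only [override_coe] at h
  rw [← h]
  refine Finset.sum_congr rfl fun z _ => ?_
  rw [hA, ite_mul, zero_mul]

theorem ActsOn.mul (hM : M.ActsOn S) (hN : N.ActsOn S) : ActsOn (M * N) S := by
  obtain ⟨A, hA⟩ := hM
  obtain ⟨A', hA'⟩ := hN
  refine ⟨A * A', fun x y => ?_⟩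
  rw [Matrix.mul_apply, ActsOn.sum_mul hA]
  have h : ∀ s : S → Bool, (∀ i, i ∉ S → override S x s i = y i) ↔ ∀ i, i ∉ S → x i = y i :=
    fun s => forall₂_congr fun i hi => by rw [override_of_notMem hi]
  simp only [hA', h, override_coe]
  split_ifs
  · rw [Matrix.mul_apply]
  · simp

theorem isDBMLimit_apply {k h : ℕ} (hS : S.card ≤ k) (hM : M.ActsOn S)
    (hpos : M.EntrywiseNonneg) {v : QubitSpace n} (hv : IsDBMLimit k h v) :
    IsDBMLimit k (h + (2 ^ (2 * k) + k)) (Matrix.toEuclideanCLM (n := BitString n) (𝕜 := ℂ) M v) := by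
  obtain ⟨A, hA⟩ := hM
  obtain ⟨f, hf, hvf⟩ := hv
  have hA0 : ∀ y s, (A y s).im = 0 ∧ 0 ≤ (A y s).re := by
    intro y s
    -- Every entry of `A` is an entry of `M` between two strings that agree off `S`; padding with
    -- `false` provides such strings.
    have h1 := hA (override S (fun _ => false) y) (override S (fun _ => false) s)
    rw [if_pos fun i hi => by rw [override_of_notMem hi, override_of_notMem hi]] at h1
    simp only [override_coe] at h1
    rw [← h1]
    exact hpos _ _
  refine ⟨_, kernel_mem_closure_dbmOutputs hS (fun y s => (hA0 y s).2) hf, fun x => ?_⟩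
  rw [Matrix.ofLp_toEuclideanCLM, Matrix.mulVec, dotProduct, ActsOn.sum_mul hA]
  push_cast
  refine Finset.sum_congr rfl fun s _ => ?_
  rw [hvf]
  congr 1
  exact Complex.ext rfl (hA0 _ _).1

end QubitMatrix

/-! ### Error of the symmetric product formula. -/

section taylor

variable {𝒜 : Type*}

/-- The second-order Taylor polynomial `1 + B + B² / 2` of the exponential. -/
noncomputable def taylorTwo [Ring 𝒜] [Algebra ℂ 𝒜] (B : 𝒜) : 𝒜 := 1 + B + (2⁻¹ : ℂ) • (B * B)

/-- The symmetric product `g₁ g₂ ⋯ gₘ gₘ ⋯ g₂ g₁` of the factors `gᵢ = 1 + Bᵢ + Bᵢ² / 2`. -/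
noncomputable def strangProduct [Ring 𝒜] [Algebra ℂ 𝒜] : List 𝒜 → 𝒜
  | [] => 1
  | B :: l => taylorTwo B * strangProduct l * taylorTwo B

theorem map_taylorTwo {ℬ F : Type*} [Ring 𝒜] [Algebra ℂ 𝒜] [Ring ℬ] [Algebra ℂ ℬ] [FunLike F 𝒜 ℬ]
    [AlgHomClass F ℂ 𝒜 ℬ] (φ : F) (B : 𝒜) : φ (taylorTwo B) = taylorTwo (φ B) := by
  simp [taylorTwo, map_smul]

/-- The palindromic order cancels everything up to second order: each remaining term has degree at
least three in `B` and `s`. All terms carry a plus sign, so the triangle inequality gives exactly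
the same expression in the norm bounds. -/
theorem taylorTwo_conj_sub [Ring 𝒜] [Algebra ℂ 𝒜] (B s : 𝒜) {q r : 𝒜}
    (hq : q = (2⁻¹ : ℂ) • (B * B)) (hr : r = (2⁻¹ : ℂ) • (s * s)) :
    taylorTwo B * taylorTwo s * taylorTwo B - taylorTwo (s + (B + B)) =
      (B + q) * r * taylorTwo B + r * (B + q) + q * s * taylorTwo B + B * s * (B + q) + s * q
        + B * q + q * B + q * q := by
  have hBB : B * B = q + q := by
    rw [hq, ← add_smul]
    norm_num
  have h1 : (2⁻¹ : ℂ) • ((s + (B + B)) * (s + (B + B))) =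
      r + s * B + B * s + (q + q + q + q) := by
    have h2 : (s + (B + B)) * (s + (B + B)) =
        s * s + (s * B + s * B) + (B * s + B * s) + (B * B + B * B + B * B + B * B) := by
      noncomm_ring
    have h3 : ∀ a : 𝒜, (2⁻¹ : ℂ) • (a + a) = a := fun a => by
      rw [← two_smul ℂ a, smul_smul]
      norm_num
    rw [h2, smul_add, smul_add, smul_add, h3, h3, smul_add, smul_add, smul_add, ← hq, ← hr]
  have hg : taylorTwo B = 1 + B + q := by rw [taylorTwo, hq]
  have hs : taylorTwo s = 1 + s + r := by rw [taylorTwo, hr]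
  rw [hg, hs, taylorTwo, h1]
  linear_combination (norm := noncomm_ring) hBB

variable [NormedRing 𝒜] [NormedAlgebra ℂ 𝒜] [NormOneClass 𝒜]

theorem norm_half_sq_le {B : 𝒜} {b : ℝ} (hB : ‖B‖ ≤ b) :
    ‖(2⁻¹ : ℂ) • (B * B)‖ ≤ b ^ 2 / 2 := by
  rw [norm_smul]
  have h1 : ‖B * B‖ ≤ b * b :=
    (norm_mul_le _ _).trans (mul_le_mul hB hB (norm_nonneg _) ((norm_nonneg _).trans hB))
  have h2 : ‖(2⁻¹ : ℂ)‖ = 1 / 2 := by norm_num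
  rw [h2]
  linarith

theorem norm_taylorTwo_le {B : 𝒜} {b : ℝ} (hB : ‖B‖ ≤ b) :
    ‖taylorTwo B‖ ≤ 1 + b + b ^ 2 / 2 := by
  refine (norm_add₃_le).trans ?_
  rw [norm_one]
  exact add_le_add (add_le_add le_rfl hB) (norm_half_sq_le hB)

theorem norm_mul_le_of_le_of_le {a c : 𝒜} {x y : ℝ} (ha : ‖a‖ ≤ x) (hc : ‖c‖ ≤ y) :
    ‖a * c‖ ≤ x * y :=
  (norm_mul_le _ _).trans (mul_le_mul ha hc (norm_nonneg _) ((norm_nonneg _).trans ha))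

theorem norm_taylorTwo_conj_sub_le {B s : 𝒜} {b x : ℝ} (hB : ‖B‖ ≤ b) (hs : ‖s‖ ≤ x) :
    ‖taylorTwo B * taylorTwo s * taylorTwo B - taylorTwo (s + (B + B))‖ ≤
      (1 + b + b ^ 2 / 2) ^ 2 * (1 + x + x ^ 2 / 2) -
        (1 + (x + 2 * b) + (x + 2 * b) ^ 2 / 2) := by
  rw [taylorTwo_conj_sub B s rfl rfl]
  have hq := norm_half_sq_le hB
  have hr := norm_half_sq_le hs
  have hg := norm_taylorTwo_le hB
  generalize (2⁻¹ : ℂ) • (B * B) = q at hq ⊢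
  generalize (2⁻¹ : ℂ) • (s * s) = r at hr ⊢
  generalize taylorTwo B = g at hg ⊢
  have hBq : ‖B + q‖ ≤ b + b ^ 2 / 2 := norm_add_le_of_le hB hq
  refine (norm_add_le_of_le (norm_add_le_of_le (norm_add_le_of_le (norm_add_le_of_le
    (norm_add_le_of_le (norm_add_le_of_le (norm_add_le_of_le
    (norm_mul_le_of_le_of_le (norm_mul_le_of_le_of_le hBq hr) hg)
    (norm_mul_le_of_le_of_le hr hBq))
    (norm_mul_le_of_le_of_le (norm_mul_le_of_le_of_le hq hs) hg))
    (norm_mul_le_of_le_of_le (norm_mul_le_of_le_of_le hB hs) hBq))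
    (norm_mul_le_of_le_of_le hs hq)) (norm_mul_le_of_le_of_le hB hq))
    (norm_mul_le_of_le_of_le hq hB)) (norm_mul_le_of_le_of_le hq hq)).trans (le_of_eq ?_)
  ring

theorem norm_list_sum_le {l : List 𝒜} {b : ℝ} (hl : ∀ B ∈ l, ‖B‖ ≤ b) :
    ‖l.sum‖ ≤ l.length * b := by
  induction l with
  | nil => simp
  | cons B l ih =>
    simp only [List.mem_cons, forall_eq_or_imp] at hl
    rw [List.sum_cons, List.length_cons]
    push_cast
    linarith [norm_add_le B l.sum, hl.1, ih hl.2]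

/-- The bound is the exponential minus its quadratic part. In the induction the quadratic part of
the old bound cancels against the conjugation error, leaving `(1 + b + b²/2)² exp x ≤ exp (x + 2b)`.
-/
theorem norm_strangProduct_sub_le {l : List 𝒜} {b : ℝ} (hl : ∀ B ∈ l, ‖B‖ ≤ b) (hb : 0 ≤ b) :
    ‖strangProduct l - taylorTwo (l.sum + l.sum)‖ ≤
      Real.exp (2 * (l.length * b)) -
        (1 + 2 * (l.length * b) + (2 * (l.length * b)) ^ 2 / 2) := by
  induction l with
  | nil => simp [strangProduct, taylorTwo]
  | cons B l ih =>
    simp only [List.mem_cons, forall_eq_or_imp] at hl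
    have ih := ih hl.2
    set x := 2 * (l.length * b) with hx
    set s := l.sum + l.sum with hs
    have hsx : ‖s‖ ≤ x := by
      have := norm_list_sum_le hl.2
      have := norm_add_le l.sum l.sum
      rw [hs, hx]
      linarith
    have hsum : (B :: l).sum + (B :: l).sum = s + (B + B) := by
      rw [List.sum_cons, hs]
      abel
    have hlen : 2 * (((B :: l).length : ℕ) * b) = x + 2 * b := by
      rw [List.length_cons, hx]
      push_cast
      ring
    rw [hsum, hlen, strangProduct]
    have hsplit : taylorTwo B * strangProduct l * taylorTwo B - taylorTwo (s + (B + B)) =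
        taylorTwo B * (strangProduct l - taylorTwo s) * taylorTwo B +
          (taylorTwo B * taylorTwo s * taylorTwo B - taylorTwo (s + (B + B))) := by
      noncomm_ring
    have hg := norm_taylorTwo_le hl.1
    have h1 := norm_mul_le_of_le_of_le (norm_mul_le_of_le_of_le hg ih) hg
    have h2 := norm_taylorTwo_conj_sub_le hl.1 hsx
    have h3 : (1 + b + b ^ 2 / 2) ^ 2 ≤ Real.exp (2 * b) := by
      have h4 : Real.exp (2 * b) = Real.exp b ^ 2 := by
        rw [← Real.exp_nat_mul]
        norm_num
      rw [h4]
      exact pow_le_pow_left₀ (by positivity) (Real.quadratic_le_exp_of_nonneg hb) 2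
    have h5 := mul_le_mul_of_nonneg_right h3 (Real.exp_nonneg x)
    rw [← Real.exp_add, add_comm (2 * b) x] at h5
    rw [hsplit]
    refine (norm_add_le_of_le h1 h2).trans ?_
    linarith

theorem exp_sub_quadratic_le {x : ℝ} (hx : 0 ≤ x) (hx1 : x ≤ 1) :
    Real.exp x - (1 + x + x ^ 2 / 2) ≤ x ^ 3 / 4 := by
  have h := Real.exp_bound' hx hx1 (n := 3) (by norm_num)
  norm_num [Finset.sum_range_succ, Nat.factorial] at h
  have : 0 ≤ x ^ 3 := by positivity
  linarith

theorem norm_pow_sub_pow_le {A P : 𝒜} {lam δ : ℝ} (hP : ‖P‖ ≤ lam) (hA : ‖A - P‖ ≤ δ) (N : ℕ) :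
    ‖A ^ N - P ^ N‖ ≤ (lam + δ) ^ N - lam ^ N := by
  have hA' : ‖A‖ ≤ lam + δ := by
    calc ‖A‖ = ‖P + (A - P)‖ := by rw [add_sub_cancel]
      _ ≤ lam + δ := norm_add_le_of_le hP hA
  induction N with
  | zero => simp
  | succ N ih =>
    have h1 : A ^ (N + 1) - P ^ (N + 1) = A ^ N * (A - P) + (A ^ N - P ^ N) * P := by
      rw [pow_succ, pow_succ]
      noncomm_ring
    have h2 : ‖A ^ N‖ ≤ (lam + δ) ^ N :=
      (norm_pow_le A N).trans (pow_le_pow_left₀ (norm_nonneg _) hA' N)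
    rw [h1]
    refine (norm_add_le_of_le (norm_mul_le_of_le_of_le h2 hA)
      (norm_mul_le_of_le_of_le ih hP)).trans (le_of_eq ?_)
    ring

end taylor

/-! ### Entrywise positivity of the gates, and products of gates on machine limits. -/

namespace QubitMatrix

variable {n : ℕ} {S : Finset (Fin n)} {M : QubitMatrix n}

/-- The operator that a matrix represents. -/
noncomputable abbrev toOp (M : QubitMatrix n) : QubitSpace n →L[ℂ] QubitSpace n :=
  Matrix.toEuclideanCLM (n := BitString n) (𝕜 := ℂ) M

theorem norm_entry_le (M : QubitMatrix n) (x y : BitString n) : ‖M x y‖ ≤ M.opNorm := by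
  have h1 : M.toOp (EuclideanSpace.single y 1) x = M x y := by
    rw [toOp, Matrix.ofLp_toEuclideanCLM]
    simp
  rw [← h1]
  refine (PiLp.norm_apply_le _ x).trans ((M.toOp.le_opNorm _).trans ?_)
  rw [PiLp.norm_single, norm_one, mul_one]
  rfl

theorem ActsOn.taylorTwo (hM : M.ActsOn S) : ActsOn (taylorTwo M) S :=
  (ActsOn.one.add hM).add ((hM.mul hM).smul _)

theorem entrywiseNonneg_taylorTwo (him : ∀ x y, (M x y).im = 0)
    (hoff : ∀ x y, x ≠ y → 0 ≤ (M x y).re) (hdiag : ∀ x, -1 ≤ (M x x).re) :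
    EntrywiseNonneg (taylorTwo M) := by
  intro x y
  have hre : (taylorTwo M x y).re = (if x = y then 1 else 0) + (M x y).re +
      2⁻¹ * ∑ z, (M x z).re * (M z y).re := by
    simp [_root_.taylorTwo, Matrix.mul_apply, Matrix.one_apply, him, apply_ite Complex.re]
  refine ⟨?_, ?_⟩
  · simp [_root_.taylorTwo, Matrix.mul_apply, Matrix.one_apply, him, apply_ite Complex.im]
  rw [hre]
  by_cases hxy : x = y
  · subst hxy
    rw [if_pos rfl, ← Finset.add_sum_erase _ _ (Finset.mem_univ x)]
    have h1 : 0 ≤ ∑ z ∈ Finset.univ.erase x, (M x z).re * (M z x).re :=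
      Finset.sum_nonneg fun z hz => mul_nonneg (hoff _ _ (Finset.ne_of_mem_erase hz).symm)
        (hoff _ _ (Finset.ne_of_mem_erase hz))
    nlinarith [hdiag x, mul_self_nonneg (M x x).re]
  -- The terms `z = x` and `z = y` of the square combine with the linear term into `M x y * (1 + (M
  -- x x + M y y) / 2)`, which is non-negative because the diagonal is at least `-1`.
  · rw [if_neg hxy, ← Finset.add_sum_erase _ _ (Finset.mem_univ x),
      ← Finset.add_sum_erase _ _ (Finset.mem_erase.mpr ⟨Ne.symm hxy, Finset.mem_univ y⟩)]
    have h1 : 0 ≤ ∑ z ∈ (Finset.univ.erase x).erase y, (M x z).re * (M z y).re :=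
      Finset.sum_nonneg fun z hz => mul_nonneg
        (hoff _ _ (Finset.ne_of_mem_erase (Finset.mem_of_mem_erase hz)).symm)
        (hoff _ _ (Finset.ne_of_mem_erase hz))
    nlinarith [hdiag x, hdiag y, hoff x y hxy, mul_nonneg (hoff x y hxy)
      (by linarith [hdiag x, hdiag y] : 0 ≤ 2 + (M x x).re + (M y y).re)]

theorem IsStoquastic.entrywiseNonneg (hM : M.IsStoquastic) {t : ℝ} (ht : 0 ≤ t)
    (htM : t * M.opNorm ≤ 1) : EntrywiseNonneg (taylorTwo ((-(t : ℂ)) • M)) := by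
  have him : ∀ x y, (M x y).im = 0 := by
    intro x y
    by_cases hxy : x = y
    · subst hxy
      have h := congrArg Complex.im (hM.1.apply x x)
      simp only [Complex.star_def, Complex.conj_im] at h
      linarith
    · exact (hM.2 x y hxy).1
  have hre : ∀ x y, (((-(t : ℂ)) • M) x y).re = -(t * (M x y).re) := fun x y => by simp [him]
  refine entrywiseNonneg_taylorTwo (fun x y => by simp [him]) (fun x y hxy => ?_) fun x => ?_
  · rw [hre]
    nlinarith [(hM.2 x y hxy).2]
  · rw [hre, neg_le_neg_iff]
    exact (mul_le_mul_of_nonneg_left ((Complex.re_le_norm _).trans (norm_entry_le M x x)) ht).trans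
      htM

theorem isDBMLimit_strangProduct {k : ℕ} {l : List (QubitMatrix n)}
    (hl : ∀ M ∈ l, IsLocal k M ∧ EntrywiseNonneg (taylorTwo M)) {h : ℕ} {v : QubitSpace n}
    (hv : IsDBMLimit k h v) :
    IsDBMLimit k (h + 2 * l.length * (2 ^ (2 * k) + k)) (strangProduct (l.map toOp) v) := by
  induction l generalizing h v with
  | nil => simpa [strangProduct] using hv
  | cons M l ih =>
    simp only [List.mem_cons, forall_eq_or_imp] at hl
    obtain ⟨⟨⟨S, hS, hM⟩, hpos⟩, hl⟩ := hl
    have h1 := isDBMLimit_apply hS hM.taylorTwo hpos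
      (ih hl (isDBMLimit_apply hS hM.taylorTwo hpos hv))
    rw [map_taylorTwo] at h1
    rw [List.map_cons, strangProduct, mul_apply_eq_comp, mul_apply_eq_comp]
    convert h1 using 1
    rw [List.length_cons]
    ring

theorem isDBMLimit_strangProduct_pow {k : ℕ} {l : List (QubitMatrix n)}
    (hl : ∀ M ∈ l, IsLocal k M ∧ EntrywiseNonneg (taylorTwo M)) {h : ℕ} {v : QubitSpace n}
    (hv : IsDBMLimit k h v) (N : ℕ) :
    IsDBMLimit k (h + N * (2 * l.length * (2 ^ (2 * k) + k)))
      ((strangProduct (l.map toOp) ^ N) v) := by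
  induction N with
  | zero => simpa using hv
  | succ N ih =>
    have h1 := isDBMLimit_strangProduct hl ih
    rw [pow_succ', mul_apply_eq_comp]
    convert h1 using 1
    ring

end QubitMatrix

theorem isDBMLimit_plusState (n k : ℕ) : IsDBMLimit k 0 (plusState n) :=
  ⟨_, subset_closure (const_mem_dbmOutputs n k
    (inv_pos.mpr (Real.sqrt_pos.mpr (by positivity : (0 : ℝ) < 2 ^ n)))), fun _ => rfl⟩

/-! ### Spectral decomposition and the power method. -/

theorem OrthonormalBasis.norm_le_of_coord_le {ι E : Type*} [Fintype ι] [NormedAddCommGroup E]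
    [InnerProductSpace ℂ E] (b : OrthonormalBasis ι ℂ E) {w v : E} {C : ℝ} (hC : 0 ≤ C)
    (h : ∀ i, ‖inner ℂ (b i) w‖ ≤ C * ‖inner ℂ (b i) v‖) : ‖w‖ ≤ C * ‖v‖ := by
  refine abs_le_of_sq_le_sq' ?_ (by positivity) |>.2
  rw [mul_pow, ← b.sum_sq_norm_inner_right, ← b.sum_sq_norm_inner_right, Finset.mul_sum]
  refine Finset.sum_le_sum fun i _ => ?_
  rw [← mul_pow]
  exact pow_le_pow_left₀ (norm_nonneg _) (h i) 2

theorem OrthonormalBasis.ext_of_inner_eq {ι E : Type*} [Fintype ι] [NormedAddCommGroup E]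
    [InnerProductSpace ℂ E] (b : OrthonormalBasis ι ℂ E) {v w : E}
    (h : ∀ i, inner ℂ (b i) v = inner ℂ (b i) w) : v = w := by
  refine b.repr.injective ?_
  ext i
  rw [b.repr_apply_apply, b.repr_apply_apply, h i]

/-- The second-order Taylor polynomial of `exp (-u)`. -/
noncomputable def decayPoly (u : ℝ) : ℝ := 1 - u + u ^ 2 / 2

theorem decayPoly_ge {u : ℝ} (hu : |u| ≤ 1 / 2) : 5 / 8 ≤ decayPoly u := by
  obtain ⟨h1, h2⟩ := abs_le.mp hu
  unfold decayPoly
  nlinarith [mul_nonneg (by linarith : 0 ≤ 1 / 2 - u) (by linarith : 0 ≤ 3 / 2 - u)]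

/-- On this interval the slope is at most `-1/2` and the value at most `2`, so an increase of `d` in
the argument costs a relative factor `1 - d/4`. -/
theorem decayPoly_le {u₀ u d : ℝ} (h₀ : |u₀| ≤ 1 / 2) (hu : |u| ≤ 1 / 2) (hd : 0 ≤ d)
    (h : u₀ + d ≤ u) : decayPoly u ≤ decayPoly u₀ * Real.exp (-(d / 4)) := by
  obtain ⟨h1, h2⟩ := abs_le.mp h₀
  obtain ⟨h3, h4⟩ := abs_le.mp hu
  have h5 : decayPoly u₀ ≤ 2 := by
    unfold decayPoly
    nlinarith
  have h6 := decayPoly_ge h₀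
  have h7 : decayPoly u₀ - decayPoly u = (u - u₀) * (1 - (u + u₀) / 2) := by
    unfold decayPoly
    ring
  have h8 : d / 2 ≤ (u - u₀) * (1 - (u + u₀) / 2) := by
    nlinarith [mul_nonneg (by linarith : 0 ≤ u - u₀) (by linarith : 0 ≤ 1 - (u + u₀))]
  have h9 : 1 - d / 4 ≤ Real.exp (-(d / 4)) := by
    linarith [Real.add_one_le_exp (-(d / 4))]
  calc decayPoly u ≤ decayPoly u₀ * (1 - d / 4) := by nlinarith
    _ ≤ _ := mul_le_mul_of_nonneg_left h9 (by linarith)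

namespace QubitMatrix

variable {n : ℕ} {M : QubitMatrix n}

theorem toOp_eigenvectorBasis (hM : M.IsHermitian) (i : BitString n) :
    M.toOp (hM.eigenvectorBasis i) = (hM.eigenvalues i : ℂ) • hM.eigenvectorBasis i := by
  ext x
  have h := congrFun (hM.mulVec_eigenvectorBasis i) x
  rw [toOp, Matrix.ofLp_toEuclideanCLM, h]
  simp

theorem toOp_isSelfAdjoint (hM : M.IsHermitian) : IsSelfAdjoint M.toOp := by
  have h : IsSelfAdjoint M := hM
  exact h.map (Matrix.toEuclideanCLM (n := BitString n) (𝕜 := ℂ))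

theorem inner_eigenvectorBasis_toOp (hM : M.IsHermitian) (i : BitString n) (v : QubitSpace n) :
    inner ℂ (hM.eigenvectorBasis i) (M.toOp v) =
      (hM.eigenvalues i : ℂ) * inner ℂ (hM.eigenvectorBasis i) v := by
  have h := (ContinuousLinearMap.isSelfAdjoint_iff_isSymmetric.mp (toOp_isSelfAdjoint hM))
    (hM.eigenvectorBasis i) v
  simp only [ContinuousLinearMap.coe_coe] at h
  rw [← h, toOp_eigenvectorBasis, inner_smul_left, Complex.conj_ofReal]

theorem energies_eq_range (hM : M.IsHermitian) : M.energies = Set.range hM.eigenvalues := by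
  ext E
  constructor
  · intro hE
    obtain ⟨v, hv⟩ := Module.End.HasEigenvalue.exists_hasEigenvector hE
    have hv' : M.toOp v = (E : ℂ) • v := hv.apply_eq_smul
    by_contra hne
    refine hv.2 (hM.eigenvectorBasis.ext_of_inner_eq fun i => ?_)
    rw [inner_zero_right]
    have h := inner_eigenvectorBasis_toOp hM i v
    rw [hv', inner_smul_right] at h
    have h1 : ((E : ℂ) - hM.eigenvalues i) * inner ℂ (hM.eigenvectorBasis i) v = 0 := by
      rw [sub_mul, h, sub_self]
    refine (mul_eq_zero.mp h1).resolve_left fun h2 => hne ⟨i, ?_⟩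
    rw [sub_eq_zero] at h2
    exact_mod_cast h2.symm
  · rintro ⟨i, rfl⟩
    refine Module.End.hasEigenvalue_of_hasEigenvector (x := hM.eigenvectorBasis i)
      ⟨?_, hM.eigenvectorBasis.toBasis.ne_zero i |> fun h => by simpa using h⟩
    rw [Module.End.mem_eigenspace_iff]
    exact toOp_eigenvectorBasis hM i

theorem exists_groundEnergy_eq (hM : M.IsHermitian) :
    ∃ i, hM.eigenvalues i = M.groundEnergy := by
  have h : M.groundEnergy ∈ M.energies := by
    rw [groundEnergy, energies_eq_range hM]
    exact (Set.range_nonempty _).csInf_mem (Set.finite_range _)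
  rwa [energies_eq_range hM] at h

theorem groundEnergy_le (hM : M.IsHermitian) (i : BitString n) :
    M.groundEnergy ≤ hM.eigenvalues i := by
  rw [groundEnergy, energies_eq_range hM]
  exact csInf_le (Set.finite_range _).bddBelow ⟨i, rfl⟩

theorem abs_eigenvalues_le (hM : M.IsHermitian) (i : BitString n) :
    |hM.eigenvalues i| ≤ M.opNorm := by
  have h := M.toOp.le_opNorm (hM.eigenvectorBasis i)
  rw [toOp_eigenvectorBasis, norm_smul, hM.eigenvectorBasis.norm_eq_one, mul_one, mul_one,
    Complex.norm_real] at h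
  exact h

/-- An eigenbasis vector either lies in the ground space or has a different eigenvalue and is
orthogonal to it; this covers degenerate ground spaces. -/
theorem inner_eigenvectorBasis_projection (hM : M.IsHermitian) (i : BitString n)
    (v : QubitSpace n) :
    inner ℂ (hM.eigenvectorBasis i) (M.groundSpace.starProjection v) =
      if hM.eigenvalues i = M.groundEnergy then inner ℂ (hM.eigenvectorBasis i) v else 0 := by
  split_ifs with hi
  · have hmem : hM.eigenvectorBasis i ∈ M.groundSpace := by
      rw [groundSpace, Module.End.mem_eigenspace_iff, ← hi]
      exact toOp_eigenvectorBasis hM i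
    rw [← Submodule.inner_starProjection_left_eq_right,
      Submodule.starProjection_eq_self_iff.mpr hmem]
  · have hmem : M.groundSpace.starProjection v ∈ M.groundSpace :=
      Submodule.starProjection_apply_mem _ _
    have h1 : M.toOp (M.groundSpace.starProjection v) =
        (M.groundEnergy : ℂ) • M.groundSpace.starProjection v :=
      Module.End.mem_eigenspace_iff.mp hmem
    have h := inner_eigenvectorBasis_toOp hM i (M.groundSpace.starProjection v)
    rw [h1, inner_smul_right] at h
    have h2 : ((M.groundEnergy : ℂ) - hM.eigenvalues i) *
        inner ℂ (hM.eigenvectorBasis i) (M.groundSpace.starProjection v) = 0 := by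
      rw [sub_mul, h, sub_self]
    refine (mul_eq_zero.mp h2).resolve_left fun h3 => hi ?_
    rw [sub_eq_zero] at h3
    exact_mod_cast h3.symm

theorem inner_eigenvectorBasis_taylorTwo (hM : M.IsHermitian) (t : ℝ) (i : BitString n)
    (v : QubitSpace n) :
    inner ℂ (hM.eigenvectorBasis i) (taylorTwo (-(t : ℂ) • M.toOp) v) =
      (decayPoly (t * hM.eigenvalues i) : ℂ) * inner ℂ (hM.eigenvectorBasis i) v := by
  simp only [taylorTwo, add_apply, smul_apply,
    mul_apply_eq_comp, one_apply_eq_self, map_smul, inner_add_right,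
    inner_smul_right, inner_eigenvectorBasis_toOp, decayPoly]
  push_cast
  ring

theorem inner_eigenvectorBasis_taylorTwo_pow (hM : M.IsHermitian) (t : ℝ) (i : BitString n)
    (v : QubitSpace n) (N : ℕ) :
    inner ℂ (hM.eigenvectorBasis i) ((taylorTwo (-(t : ℂ) • M.toOp) ^ N) v) =
      (decayPoly (t * hM.eigenvalues i) : ℂ) ^ N * inner ℂ (hM.eigenvectorBasis i) v := by
  induction N with
  | zero => simp
  | succ N ih =>
    rw [pow_succ', mul_apply_eq_comp, inner_eigenvectorBasis_taylorTwo, ih]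
    ring

theorem abs_mul_eigenvalues_le (hM : M.IsHermitian) {t : ℝ} (ht : 0 ≤ t)
    (htM : t * M.opNorm ≤ 1 / 2) (i : BitString n) : |t * hM.eigenvalues i| ≤ 1 / 2 := by
  rw [abs_mul, abs_of_nonneg ht]
  exact (mul_le_mul_of_nonneg_left (abs_eigenvalues_le hM i) ht).trans htM

theorem abs_mul_groundEnergy_le (hM : M.IsHermitian) {t : ℝ} (ht : 0 ≤ t)
    (htM : t * M.opNorm ≤ 1 / 2) : |t * M.groundEnergy| ≤ 1 / 2 := by
  obtain ⟨i, hi⟩ := exists_groundEnergy_eq hM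
  rw [← hi]
  exact abs_mul_eigenvalues_le hM ht htM i

theorem norm_taylorTwo_toOp_le (hM : M.IsHermitian) {t : ℝ} (ht : 0 ≤ t)
    (htM : t * M.opNorm ≤ 1 / 2) :
    ‖taylorTwo (-(t : ℂ) • M.toOp)‖ ≤ decayPoly (t * M.groundEnergy) := by
  have h0 := abs_mul_groundEnergy_le hM ht htM
  have hpos : 0 ≤ decayPoly (t * M.groundEnergy) := by linarith [decayPoly_ge h0]
  refine ContinuousLinearMap.opNorm_le_bound _ hpos fun v =>
    hM.eigenvectorBasis.norm_le_of_coord_le hpos fun i => ?_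
  have hi := abs_mul_eigenvalues_le hM ht htM i
  rw [inner_eigenvectorBasis_taylorTwo, norm_mul, Complex.norm_real, Real.norm_of_nonneg
    (by linarith [decayPoly_ge hi])]
  refine mul_le_mul_of_nonneg_right ?_ (norm_nonneg _)
  have := decayPoly_le h0 hi le_rfl
    (by simpa using mul_le_mul_of_nonneg_left (groundEnergy_le hM i) ht)
  simpa using this

theorem norm_taylorTwo_pow_sub_projection_le (hM : M.IsHermitian) {t Δ : ℝ} (ht : 0 ≤ t)
    (htM : t * M.opNorm ≤ 1 / 2) (hgap : M.HasEnergyGap Δ) (N : ℕ) (v : QubitSpace n) :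
    ‖(taylorTwo (-(t : ℂ) • M.toOp) ^ N) v -
        ((decayPoly (t * M.groundEnergy) ^ N : ℝ) : ℂ) • M.groundSpace.starProjection v‖ ≤
      decayPoly (t * M.groundEnergy) ^ N * Real.exp (-(N * t * Δ / 4)) * ‖v‖ := by
  have h0 := abs_mul_groundEnergy_le hM ht htM
  have hpos : 0 ≤ decayPoly (t * M.groundEnergy) := by linarith [decayPoly_ge h0]
  refine hM.eigenvectorBasis.norm_le_of_coord_le (by positivity) fun i => ?_
  rw [inner_sub_right, inner_smul_right, inner_eigenvectorBasis_taylorTwo_pow,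
    inner_eigenvectorBasis_projection]
  split_ifs with hE
  · rw [hE]
    push_cast
    rw [sub_self, norm_zero]
    positivity
  · have hi := abs_mul_eigenvalues_le hM ht htM i
    have hge := decayPoly_ge hi
    rw [mul_zero, sub_zero, norm_mul, norm_pow, Complex.norm_real,
      Real.norm_of_nonneg (by linarith)]
    refine mul_le_mul_of_nonneg_right ?_ (norm_nonneg _)
    have hmem : hM.eigenvalues i ∈ M.energies := by
      rw [energies_eq_range hM]
      exact ⟨i, rfl⟩
    have hstep := decayPoly_le h0 hi (mul_nonneg ht hgap.1.le)
      (by rw [← mul_add]; exact mul_le_mul_of_nonneg_left (hgap.2 _ hmem hE) ht)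
    refine (pow_le_pow_left₀ (by linarith) hstep N).trans (le_of_eq ?_)
    rw [mul_pow, ← Real.exp_nat_mul]
    congr 2
    ring

theorem projection_eq_self_of_gap (hM : M.IsHermitian) {Δ : ℝ} (hgap : M.HasEnergyGap Δ)
    (h : 2 * M.opNorm < Δ) (v : QubitSpace n) : M.groundSpace.starProjection v = v := by
  refine hM.eigenvectorBasis.ext_of_inner_eq fun i => ?_
  rw [inner_eigenvectorBasis_projection, if_pos]
  by_contra hE
  have hmem : hM.eigenvalues i ∈ M.energies := by
    rw [energies_eq_range hM]
    exact ⟨i, rfl⟩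
  have h1 := hgap.2 _ hmem hE
  obtain ⟨j, hj⟩ := exists_groundEnergy_eq hM
  rw [← hj] at h1
  linarith [(abs_le.mp (abs_eigenvalues_le hM i)).2, (abs_le.mp (abs_eigenvalues_le hM j)).1]

theorem opNorm_sum_le {L : ℕ} {H : Fin L → QubitMatrix n} {J : ℝ} (hJ : ∀ a, (H a).opNorm ≤ J) :
    opNorm (∑ a, H a) ≤ L * J := by
  unfold opNorm
  rw [map_sum]
  refine (norm_sum_le _ _).trans ((Finset.sum_le_sum fun a _ => hJ a).trans (le_of_eq ?_))
  simp

end QubitMatrix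

/-! ### The overlap `η` and the normalised ground state. -/

theorem norm_plusState (n : ℕ) : ‖plusState n‖ = 1 := by
  rw [EuclideanSpace.norm_eq, Real.sqrt_eq_one]
  simp [plusState, BitString]

namespace QubitMatrix

variable {n : ℕ} (M : QubitMatrix n)

theorem inner_plusState_projectedPlus :
    inner ℂ (plusState n) M.projectedPlus = ((‖M.projectedPlus‖ ^ 2 : ℝ) : ℂ) := by
  have h : M.groundSpace.starProjection M.projectedPlus = M.projectedPlus :=
    Submodule.starProjection_eq_self_iff.mpr (Submodule.starProjection_apply_mem _ _)
  rw [← h, ← Submodule.inner_starProjection_left_eq_right, h]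
  change inner ℂ M.projectedPlus M.projectedPlus = _
  rw [inner_self_eq_norm_sq_to_K]
  push_cast
  rfl

theorem plusOverlap_eq : M.plusOverlap = ‖M.projectedPlus‖ := by
  rw [plusOverlap, inner_plusState_projectedPlus, Complex.ofReal_re, Real.sqrt_sq (norm_nonneg _)]

theorem plusOverlap_le_one : M.plusOverlap ≤ 1 := by
  rw [plusOverlap_eq, ← norm_plusState n]
  exact Submodule.norm_starProjection_apply_le _ _

variable {M}

theorem norm_groundState (h : 0 < M.plusOverlap) : ‖M.groundState‖ = 1 := by
  rw [groundState, norm_smul, Complex.norm_real, norm_inv, Real.norm_of_nonneg h.le,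
    ← plusOverlap_eq, inv_mul_cancel₀ h.ne']

theorem norm_plusState_sub_groundState (h : 0 < M.plusOverlap) :
    ‖plusState n - M.groundState‖ ^ 2 = 2 - 2 * M.plusOverlap := by
  rw [@norm_sub_sq ℂ, norm_plusState, norm_groundState h, groundState, inner_smul_right,
    inner_plusState_projectedPlus, ← plusOverlap_eq, ← Complex.ofReal_mul]
  change 1 ^ 2 - 2 * (((M.plusOverlap⁻¹ * M.plusOverlap ^ 2 : ℝ) : ℂ)).re + 1 ^ 2 = _
  rw [Complex.ofReal_re]
  field_simp
  ring

theorem projectedPlus_eq (h : 0 < M.plusOverlap) :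
    M.projectedPlus = (M.plusOverlap : ℂ) • M.groundState := by
  rw [groundState, smul_smul, ← Complex.ofReal_mul, mul_inv_cancel₀ h.ne', Complex.ofReal_one,
    one_smul]

end QubitMatrix

/-! ### From norm distance of states to total variation. -/

section totalVariation

variable {n : ℕ}

theorem sum_mul_norm_le (u v : QubitSpace n) : ∑ x, ‖u x‖ * ‖v x‖ ≤ ‖u‖ * ‖v‖ := by
  rw [EuclideanSpace.norm_eq, EuclideanSpace.norm_eq]
  exact Real.sum_mul_le_sqrt_mul_sqrt _ _ _

theorem sum_abs_sq_sub_sq_le (u v : QubitSpace n) :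
    ∑ x, |‖u x‖ ^ 2 - ‖v x‖ ^ 2| ≤ ‖u - v‖ * (‖u‖ + ‖v‖) := by
  calc ∑ x, |‖u x‖ ^ 2 - ‖v x‖ ^ 2|
      ≤ ∑ x, (‖(u - v) x‖ * ‖u x‖ + ‖(u - v) x‖ * ‖v x‖) := by
        refine Finset.sum_le_sum fun x _ => ?_
        rw [sq_sub_sq, abs_mul, abs_of_nonneg (by positivity), mul_comm, ← mul_add]
        exact mul_le_mul_of_nonneg_right (abs_norm_sub_norm_le _ _) (by positivity)
    _ ≤ ‖u - v‖ * (‖u‖ + ‖v‖) := by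
        rw [Finset.sum_add_distrib, mul_add]
        exact add_le_add (sum_mul_norm_le _ _) (sum_mul_norm_le _ _)

/-- Replacing `‖u x‖²` by its normalisation moves total mass `|1 - s|`, itself at most the
unnormalised `ℓ¹` distance since `v` is a unit vector. The resulting factor `2` cancels the `1/2` in
`tvDist`. -/
theorem tvDist_le_of_norm_sub_le {u v : QubitSpace n} {θ : ℝ} (hv : ‖v‖ = 1)
    (huv : ‖u - v‖ ≤ θ) (hθ : θ < 1) :
    0 < ∑ y, ‖u y‖ ^ 2 ∧
      tvDist (fun x => ‖u x‖ ^ 2 / ∑ y, ‖u y‖ ^ 2) (fun x => ‖v x‖ ^ 2) ≤ θ * (2 + θ) := by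
  have hsum := (EuclideanSpace.norm_sq_eq u).symm
  have hvsum : ∑ y, ‖v y‖ ^ 2 = 1 := by rw [← EuclideanSpace.norm_sq_eq, hv, one_pow]
  have hu1 : ‖u‖ ≤ 1 + θ := by
    have := norm_sub_norm_le u v
    linarith
  have hu0 : 0 < ‖u‖ := by
    have := norm_sub_norm_le v u
    rw [norm_sub_rev] at this
    linarith
  have hθ0 : 0 ≤ θ := (norm_nonneg _).trans huv
  have hs0 : 0 < ∑ y, ‖u y‖ ^ 2 := by
    rw [hsum]
    positivity
  refine ⟨hs0, ?_⟩
  set s := ∑ y, ‖u y‖ ^ 2 with hs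
  have hdiff : ∑ x, |‖u x‖ ^ 2 - ‖v x‖ ^ 2| ≤ θ * (2 + θ) :=
    (sum_abs_sq_sub_sq_le u v).trans
      (mul_le_mul huv (by rw [hv]; linarith) (by positivity) hθ0)
  have hnorm : ∑ x, |‖u x‖ ^ 2 / s - ‖u x‖ ^ 2| = |1 - s| := by
    have h1 : ∀ x, |‖u x‖ ^ 2 / s - ‖u x‖ ^ 2| = ‖u x‖ ^ 2 * (|1 - s| / s) := by
      intro x
      have h2 : ‖u x‖ ^ 2 / s - ‖u x‖ ^ 2 = ‖u x‖ ^ 2 * ((1 - s) / s) := by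
        field_simp
      rw [h2, abs_mul, abs_div, abs_of_pos hs0, abs_of_nonneg (by positivity : 0 ≤ ‖u x‖ ^ 2)]
    simp only [h1]
    rw [← Finset.sum_mul, ← hs]
    field_simp
  have hs1 : |1 - s| ≤ θ * (2 + θ) := by
    refine le_trans ?_ hdiff
    rw [← hvsum, hs, ← Finset.sum_sub_distrib, abs_le']
    constructor
    · exact Finset.sum_le_sum fun x _ => by rw [abs_sub_comm]; exact le_abs_self _
    · rw [← Finset.sum_neg_distrib]
      exact Finset.sum_le_sum fun x _ => by rw [neg_sub]; exact le_abs_self _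
  have htri : ∑ x, |‖u x‖ ^ 2 / s - ‖v x‖ ^ 2| ≤
      ∑ x, |‖u x‖ ^ 2 / s - ‖u x‖ ^ 2| + ∑ x, |‖u x‖ ^ 2 - ‖v x‖ ^ 2| := by
    rw [← Finset.sum_add_distrib]
    exact Finset.sum_le_sum fun x _ => abs_sub_le _ _ _
  rw [tvDist]
  linarith

theorem tvDist_uniform_le {M : QubitMatrix n} (h : 0 < M.plusOverlap) :
    tvDist (trivialDBM (Fin n) (Fin 0) (Fin 0)).distribution M.groundDistribution ≤
      ‖plusState n - M.groundState‖ := by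
  have h1 : (trivialDBM (Fin n) (Fin 0) (Fin 0)).distribution =
      fun x => ‖plusState n x‖ ^ 2 := by
    funext x
    simp [DBM.distribution, trivialDBM_output, plusState, BitString]
  have h2 := sum_abs_sq_sub_sq_le (plusState n) M.groundState
  rw [norm_plusState, QubitMatrix.norm_groundState h] at h2
  rw [h1, tvDist]
  unfold QubitMatrix.groundDistribution
  linarith

end totalVariation

/-! ### The machine for a given step size and number of steps. -/

namespace QubitMatrix

variable {n L : ℕ} {H : Fin L → QubitMatrix n} {J Δ : ℝ}

/-- The generators `-(t / 2) H_a` of a symmetric product formula with time step `t`. -/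
noncomputable def halfSteps (H : Fin L → QubitMatrix n) (t : ℝ) : List (QubitMatrix n) :=
  List.ofFn fun a => (-((t / 2 : ℝ) : ℂ)) • H a

theorem isHermitian_sum (hH : ∀ a, (H a).IsHermitian) : Matrix.IsHermitian (∑ a, H a) := by
  rw [Matrix.IsHermitian, Matrix.conjTranspose_sum]
  exact Finset.sum_congr rfl fun a _ => hH a

theorem norm_strangProduct_halfSteps_sub_le {t : ℝ} (ht : 0 ≤ t) (hJ0 : 0 ≤ J)
    (hJ : ∀ a, (H a).opNorm ≤ J) (hx : t * (L * J) ≤ 1 / 2) :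
    ‖strangProduct ((halfSteps H t).map toOp) - taylorTwo (-(t : ℂ) • toOp (∑ a, H a))‖ ≤
      (t * (L * J)) ^ 3 / 4 := by
  have hnorm : ∀ B ∈ (halfSteps H t).map toOp, ‖B‖ ≤ t / 2 * J := by
    intro B hB
    simp only [halfSteps, List.map_ofFn, List.mem_ofFn, Function.comp] at hB
    obtain ⟨a, rfl⟩ := hB
    rw [toOp, map_smul, norm_smul, norm_neg, Complex.norm_real, Real.norm_of_nonneg (by positivity)]
    exact mul_le_mul_of_nonneg_left (hJ a) (by positivity)
  have hsum : ((halfSteps H t).map toOp).sum + ((halfSteps H t).map toOp).sum =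
      -(t : ℂ) • toOp (∑ a, H a) := by
    have h1 : ((halfSteps H t).map toOp).sum = (-((t / 2 : ℝ) : ℂ)) • toOp (∑ a, H a) := by
      simp only [halfSteps, List.map_ofFn, List.sum_ofFn, Function.comp, toOp, map_smul, map_sum,
        Finset.smul_sum]
    have h2 : (-(t : ℂ)) = -((t / 2 : ℝ) : ℂ) + -((t / 2 : ℝ) : ℂ) := by
      push_cast
      ring
    rw [h1, h2]
    exact (add_smul _ _ _).symm
  have hlen : 2 * (((halfSteps H t).map toOp).length * (t / 2 * J)) = t * (L * J) := by
    rw [List.length_map, halfSteps, List.length_ofFn]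
    ring
  have h := norm_strangProduct_sub_le hnorm (by positivity)
  rw [hsum, hlen] at h
  exact h.trans (exp_sub_quadratic_le (by positivity) (by linarith))

theorem norm_strangProduct_pow_sub_projection_le {t ω : ℝ} (hH : ∀ a, (H a).IsHermitian)
    (ht : 0 ≤ t) (hJ0 : 0 ≤ J) (hJ : ∀ a, (H a).opNorm ≤ J) (hx : t * (L * J) ≤ 1 / 2)
    (hgap : HasEnergyGap (∑ a, H a) Δ) (hω1 : ω ≤ 1) (N : ℕ)
    (hdecay : Real.exp (-(N * t * Δ / 4)) ≤ ω / 12)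
    (hstep : N * (t * (L * J)) ^ 3 * (2 / 5) ≤ ω / 24) :
    ‖(strangProduct ((halfSteps H t).map toOp) ^ N) (plusState n) -
        ((decayPoly (t * groundEnergy (∑ a, H a)) ^ N : ℝ) : ℂ) • projectedPlus (∑ a, H a)‖ ≤
      decayPoly (t * groundEnergy (∑ a, H a)) ^ N * (ω / 6) := by
  set M := ∑ a, H a with hM
  have hMh : M.IsHermitian := isHermitian_sum hH
  have htM : t * M.opNorm ≤ 1 / 2 :=
    (mul_le_mul_of_nonneg_left (opNorm_sum_le hJ) ht).trans hx
  have hlam := decayPoly_ge (abs_mul_groundEnergy_le hMh ht htM)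
  have hP := norm_taylorTwo_toOp_le hMh ht htM
  have hproj := norm_taylorTwo_pow_sub_projection_le hMh ht htM hgap N (plusState n)
  set lam := decayPoly (t * M.groundEnergy)
  set x := t * (L * J) with hxdef
  have hx0 : 0 ≤ x := by positivity
  have hpow := norm_pow_sub_pow_le hP (norm_strangProduct_halfSteps_sub_le ht hJ0 hJ hx) N
  set A := strangProduct ((halfSteps H t).map toOp)
  set P := taylorTwo (-(t : ℂ) • toOp M)
  have hlam0 : 0 < lam := by linarith
  have hexp : (lam + x ^ 3 / 4) ^ N ≤ lam ^ N * (1 + ω / 12) := by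
    -- `lam ≥ 5/8` turns the absolute error `x³/4` into the relative error `2x³/5`.
    have h1 : lam + x ^ 3 / 4 ≤ lam * (1 + x ^ 3 * (2 / 5)) := by
      nlinarith [pow_nonneg hx0 3]
    have h2 : 1 + x ^ 3 * (2 / 5) ≤ Real.exp (x ^ 3 * (2 / 5)) := by
      linarith [Real.add_one_le_exp (x ^ 3 * (2 / 5))]
    have h3 : Real.exp (N * (x ^ 3 * (2 / 5))) ≤ 1 + ω / 12 := by
      set y := N * (x ^ 3 * (2 / 5)) with hy
      have hy0 : 0 ≤ y := by positivity
      have hyω : y ≤ ω / 24 := by rw [hy, ← mul_assoc]; exact hstep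
      have h4 := Real.exp_bound' hy0 (by linarith) (n := 1) (by norm_num)
      norm_num at h4
      linarith
    calc (lam + x ^ 3 / 4) ^ N ≤ (lam * Real.exp (x ^ 3 * (2 / 5))) ^ N :=
          pow_le_pow_left₀ (by positivity)
            (h1.trans (mul_le_mul_of_nonneg_left h2 hlam0.le)) N
      _ = lam ^ N * Real.exp (N * (x ^ 3 * (2 / 5))) := by
          rw [mul_pow, ← Real.exp_nat_mul]
      _ ≤ _ := mul_le_mul_of_nonneg_left h3 (by positivity)
  have hdiff : ‖(A ^ N) (plusState n) - (P ^ N) (plusState n)‖ ≤ lam ^ N * (ω / 12) := by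
    have h1 := (A ^ N - P ^ N).le_opNorm (plusState n)
    rw [norm_plusState, mul_one] at h1
    exact h1.trans (by linarith)
  rw [norm_plusState, mul_one] at hproj
  have hsum := norm_sub_le_norm_sub_add_norm_sub ((A ^ N) (plusState n)) ((P ^ N) (plusState n))
    (((lam ^ N : ℝ) : ℂ) • M.projectedPlus)
  have h5 : lam ^ N * Real.exp (-(N * t * Δ / 4)) ≤ lam ^ N * (ω / 12) :=
    mul_le_mul_of_nonneg_left hdecay (by positivity)
  have h6 := hproj.trans h5
  change ‖(P ^ N) (plusState n) - ((lam ^ N : ℝ) : ℂ) • M.projectedPlus‖ ≤ _ at h6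
  linarith

theorem exists_dbm_of_step {k : ℕ} {t ε : ℝ} (hloc : ∀ a, (H a).IsLocal k)
    (hsto : ∀ a, (H a).IsStoquastic) (ht : 0 ≤ t) (hJ0 : 0 ≤ J) (hJ : ∀ a, (H a).opNorm ≤ J)
    (hx : t * (L * J) ≤ 1 / 2) (htJ : t * J ≤ 1 / 2) (hgap : HasEnergyGap (∑ a, H a) Δ)
    (hη : 0 < plusOverlap (∑ a, H a)) (hε : 0 < ε) (hε1 : ε ≤ 1) (N : ℕ)
    (hdecay : Real.exp (-(N * t * Δ / 4)) ≤ plusOverlap (∑ a, H a) * ε / 12)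
    (hstep : N * (t * (L * J)) ^ 3 * (2 / 5) ≤ plusOverlap (∑ a, H a) * ε / 24) :
    ∃ (m d : ℕ) (B : DBM (Fin n) (Fin m) (Fin d)),
      m + d ≤ 2 * (N * (2 * L * (2 ^ (2 * k) + k))) ∧ B.ConnectionsLE (2 ^ (2 * k + 1)) ∧
      tvDist B.distribution (groundDistribution (∑ a, H a)) ≤ ε := by
  have hgates : ∀ B ∈ halfSteps H t, IsLocal k B ∧ EntrywiseNonneg (taylorTwo B) := by
    intro B hB
    simp only [halfSteps, List.mem_ofFn] at hB
    obtain ⟨a, rfl⟩ := hB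
    obtain ⟨S, hS, hact⟩ := hloc a
    refine ⟨⟨S, hS, hact.smul _⟩, (hsto a).entrywiseNonneg (by positivity) ?_⟩
    have := mul_le_mul_of_nonneg_left (hJ a) ht
    linarith
  have hlen : (halfSteps H t).length = L := by rw [halfSteps, List.length_ofFn]
  obtain ⟨f, hf, hvf⟩ := isDBMLimit_strangProduct_pow hgates (isDBMLimit_plusState n k) N
  rw [hlen, zero_add] at hf
  set η := plusOverlap (∑ a, H a)
  have hη1 : η ≤ 1 := plusOverlap_le_one _
  have happrox := norm_strangProduct_pow_sub_projection_le (fun a => (hsto a).1) ht hJ0 hJ hx hgap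
    (by nlinarith) N hdecay hstep
  have hMh := isHermitian_sum fun a => (hsto a).1
  have hlam := decayPoly_ge (abs_mul_groundEnergy_le hMh ht
    ((mul_le_mul_of_nonneg_left (opNorm_sum_le hJ) ht).trans hx))
  set v := (strangProduct ((halfSteps H t).map toOp) ^ N) (plusState n)
  set lam := decayPoly (t * groundEnergy (∑ a, H a))
  have hlamN : 0 < lam ^ N := pow_pos (by linarith) N
  rw [projectedPlus_eq hη, smul_smul, ← Complex.ofReal_mul] at happrox
  set c : ℝ := lam ^ N * η
  have hc : 0 < c := mul_pos hlamN hη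
  set u : QubitSpace n := ((c⁻¹ : ℝ) : ℂ) • v with hu
  -- Rescaling by `lam^N * η` divides the error `lam^N * (ηε/6)` by `η`.
  have hdist : ‖u - groundState (∑ a, H a)‖ ≤ ε / 6 := by
    have h1 : u - groundState (∑ a, H a) =
        ((c⁻¹ : ℝ) : ℂ) • (v - (c : ℂ) • groundState (∑ a, H a)) := by
      rw [smul_sub, smul_smul, ← Complex.ofReal_mul, inv_mul_cancel₀ hc.ne', Complex.ofReal_one,
        one_smul]
    rw [h1, norm_smul, Complex.norm_real, norm_inv, Real.norm_of_nonneg hc.le,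
      inv_mul_le_iff₀ hc]
    exact happrox.trans (le_of_eq (by simp only [c]; ring))
  have hux : ∀ x, ‖u x‖ ^ 2 = (c⁻¹) ^ 2 * f x ^ 2 := by
    intro x
    rw [hu, PiLp.smul_apply, hvf, smul_eq_mul, ← Complex.ofReal_mul, Complex.norm_real,
      Real.norm_eq_abs, sq_abs, mul_pow]
  obtain ⟨hpos, htv⟩ := tvDist_le_of_norm_sub_le (norm_groundState hη) hdist (by linarith)
  have hc2 : 0 < (c⁻¹) ^ 2 := by positivity
  simp only [hux, ← Finset.mul_sum, mul_div_mul_left _ _ hc2.ne'] at hpos htv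
  exact exists_dbm_of_mem_closure hf (pos_of_mul_pos_right hpos hc2.le)
    (htv.trans_lt (by nlinarith))

end QubitMatrix

/-! ### Choice of parameters and the final count. -/

theorem exists_step_count {X ω : ℝ} (hX : 1 ≤ X) (hω : 0 < ω) (hω1 : ω ≤ 1) :
    ∃ N : ℕ, 0 < N ∧ 2 * X ≤ N ∧ N * (X / N) ^ 3 * (2 / 5) ≤ ω / 24 ∧
      (N : ℝ) ≤ 5 * (X ^ (3 / 2 : ℝ) * ω ^ (-(1 / 2) : ℝ)) := by
  set Y := X ^ (3 / 2 : ℝ) * ω ^ (-(1 / 2) : ℝ) with hY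
  have hX0 : 0 < X := by linarith
  have hω' : 1 ≤ ω ^ (-(1 / 2) : ℝ) :=
    Real.one_le_rpow_of_pos_of_le_one_of_nonpos hω hω1 (by norm_num)
  have hX' : X ≤ X ^ (3 / 2 : ℝ) := by
    simpa using Real.rpow_le_rpow_of_exponent_le hX (by norm_num : (1 : ℝ) ≤ 3 / 2)
  have hYX : X ≤ Y := by nlinarith
  have hY2 : Y ^ 2 = X ^ 3 / ω := by
    rw [hY, mul_pow, ← Real.rpow_natCast, ← Real.rpow_natCast, ← Real.rpow_mul hX0.le,
      ← Real.rpow_mul hω.le]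
    norm_num
    rw [Real.rpow_neg_one, div_eq_mul_inv]
  -- With `N ≥ 4Y` the error `(2/5) X³/N²` is at most `ω/40`; since `Y ≥ X ≥ 1`, also `N ≥ 2X`, and
  -- rounding up stays below `5Y`.
  refine ⟨⌈4 * Y⌉₊, Nat.ceil_pos.mpr (by linarith), ?_, ?_, ?_⟩
  · linarith [Nat.le_ceil (4 * Y)]
  · have hN := Nat.le_ceil (4 * Y)
    set N : ℝ := (⌈4 * Y⌉₊ : ℝ)
    have hN0 : 0 < N := by linarith
    have h1 : 16 * (X ^ 3 / ω) ≤ N ^ 2 := by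
      rw [← hY2]
      nlinarith
    rw [← mul_div_assoc, div_le_iff₀ hω] at h1
    have h2 : N * (X / N) ^ 3 * (2 / 5) = X ^ 3 * (2 / 5) / N ^ 2 := by
      field_simp
    rw [h2, div_le_iff₀ (by positivity)]
    nlinarith [pow_pos hX0 3]
  · linarith [Nat.ceil_lt_add_one (by linarith : 0 ≤ 4 * Y)]

theorem log_twelve_le : Real.log 12 ≤ 5 / 2 := by
  rw [Real.log_le_iff_le_exp (by norm_num)]
  have h1 : Real.exp (5 / 2) ^ 2 = Real.exp 1 ^ 5 := by
    rw [← Real.exp_nat_mul, ← Real.exp_nat_mul]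
    norm_num
  have h2 : (2.718 : ℝ) ^ 5 ≤ Real.exp 1 ^ 5 :=
    pow_le_pow_left₀ (by norm_num) (by linarith [Real.exp_one_gt_d9]) 5
  nlinarith [Real.exp_pos (5 / 2)]

theorem log_ge_half {ω : ℝ} (hω : 0 < ω) (h : ω ^ 2 ≤ 1 / 3) : 1 / 2 ≤ Real.log ω⁻¹ := by
  rw [Real.le_log_iff_exp_le (by positivity)]
  have h1 : Real.exp (1 / 2) ^ 2 = Real.exp 1 := by
    rw [← Real.exp_nat_mul]
    norm_num
  have h2 : 3 ≤ ω⁻¹ ^ 2 := by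
    rw [inv_pow, le_inv_comm₀ (by norm_num) (by positivity)]
    linarith
  refine le_of_sq_le_sq ?_ (by positivity)
  rw [h1]
  linarith [Real.exp_one_lt_d9]

theorem step_bound_eq {L J Δ l η ε : ℝ} (hL : 0 < L) (hJ : 0 ≤ J) (hΔ : 0 < Δ) (hl : 0 ≤ l)
    (hη : 0 < η) (hε : 0 < ε) :
    L * ((24 * (L * J * l / Δ)) ^ (3 / 2 : ℝ) * (η * ε) ^ (-(1 / 2) : ℝ)) =
      24 ^ (3 / 2 : ℝ) * (η ^ (-(1 / 2) : ℝ) * L ^ (5 / 2 : ℝ) * J ^ (3 / 2 : ℝ) *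
        Δ ^ (-(3 / 2) : ℝ) * ε ^ (-(1 / 2) : ℝ) * l ^ (3 / 2 : ℝ)) := by
  have h1 : L ^ (5 / 2 : ℝ) = L * L ^ (3 / 2 : ℝ) := by
    rw [show (5 / 2 : ℝ) = 1 + 3 / 2 by norm_num, Real.rpow_add hL, Real.rpow_one]
  rw [h1, Real.mul_rpow (by norm_num) (by positivity), Real.div_rpow (by positivity) hΔ.le,
    Real.mul_rpow (by positivity) hl, Real.mul_rpow hL.le hJ, Real.mul_rpow hη.le hε.le,
    Real.rpow_neg hΔ.le]
  ring

theorem mainTheorem7 :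
    ∃ C : ℝ, 0 < C ∧
      ∀ (n k L : ℕ) (H : Fin L → QubitMatrix n) (J Δ ε : ℝ),
        (∀ a, (H a).IsLocal k) →
        (∀ a, (H a).IsStoquastic) →
        0 ≤ J → (∀ a, (H a).opNorm ≤ J) →
        QubitMatrix.HasEnergyGap (∑ a, H a) Δ →
        0 < QubitMatrix.plusOverlap (∑ a, H a) →
        0 < ε → ε ≤ 1 →
        ∃ (m d : ℕ) (B : DBM (Fin n) (Fin m) (Fin d)),
          tvDist B.distribution (QubitMatrix.groundDistribution (∑ a, H a)) ≤ ε ∧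
          ((m + d : ℕ) : ℝ) ≤
            C * (2 ^ (2 * k) * QubitMatrix.plusOverlap (∑ a, H a) ^ (-(1 / 2) : ℝ)
              * (L : ℝ) ^ (5 / 2 : ℝ) * J ^ (3 / 2 : ℝ) * Δ ^ (-(3 / 2) : ℝ)
              * ε ^ (-(1 / 2) : ℝ)
              * Real.log ((QubitMatrix.plusOverlap (∑ a, H a))⁻¹ * ε⁻¹) ^ (3 / 2 : ℝ)) ∧
          B.ConnectionsLE (2 ^ (2 * k + 1)) := by
  -- `40 = 4 · 5 · 2`: two copies of `2L` gates per step, `N ≤ 5Y`, and `4^k + k ≤ 2 · 4^k`. The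
  -- `24` comes from `hXle`.
  refine ⟨40 * 24 ^ (3 / 2 : ℝ), by positivity, ?_⟩
  intro n k L H J Δ ε hloc hsto hJ0 hJ hgap hη hε hε1
  set M := ∑ a, H a with hM
  have hη1 : M.plusOverlap ≤ 1 := M.plusOverlap_le_one
  have hMh : M.IsHermitian := QubitMatrix.isHermitian_sum fun a => (hsto a).1
  have hΔ : 0 < Δ := hgap.1
  rw [← mul_inv]
  set η := M.plusOverlap with hηdef
  have hω : 0 < η * ε := mul_pos hη hε
  have hω1 : η * ε ≤ 1 := by nlinarith
  have hlog : 0 ≤ Real.log (η * ε)⁻¹ := Real.log_nonneg (one_le_inv₀ hω |>.mpr hω1)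
  have hplus := QubitMatrix.norm_plusState_sub_groundState hη
  -- The logarithm in the bound may vanish. If `η` is this close to `1`, the uniform distribution is
  -- already within `ε` and no hidden node is needed; otherwise `ηε` is bounded away from `1`.
  by_cases hcase : 2 - 2 * η ≤ ε ^ 2
  · refine ⟨0, 0, trivialDBM _ _ _, (tvDist_uniform_le hη).trans ?_, ?_, ?_⟩
    · refine le_of_sq_le_sq ?_ hε.le
      rw [hplus]
      exact hcase
    · rw [add_zero, Nat.cast_zero]
      positivity
    · refine ⟨fun i => ?_, fun j => j.elim0, fun l => l.elim0⟩
      simp [DBM.visibleDegree, trivialDBM]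
  · rw [not_le] at hcase
    have hω3 : (η * ε) ^ 2 ≤ 1 / 3 := by
      rw [mul_pow]
      have h1 : η ^ 2 * ε ^ 2 ≤ η ^ 2 * (2 - 2 * η) :=
        mul_le_mul_of_nonneg_left hcase.le (sq_nonneg _)
      -- The maximum of `2η²(1 - η)` is `8/27`, attained at `η = 2/3`.
      nlinarith [mul_nonneg hη.le (sq_nonneg (η - 2 / 3)), sq_nonneg (η - 2 / 3)]
    have hl := log_ge_half hω hω3
    set l := Real.log (η * ε)⁻¹ with hldef
    -- A gap exceeding the spectral width would make `H` a scalar, hence `η = 1`, which the present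
    -- case excludes.
    have hΔLJ : Δ ≤ 2 * (L * J) := by
      by_contra hlt
      rw [not_le] at hlt
      have h1 := QubitMatrix.projection_eq_self_of_gap hMh hgap
        (lt_of_le_of_lt (mul_le_mul_of_nonneg_left (QubitMatrix.opNorm_sum_le hJ) (by norm_num))
          hlt) (plusState n)
      have h2 : η = 1 := by
        rw [hηdef, QubitMatrix.plusOverlap_eq, QubitMatrix.projectedPlus, h1, norm_plusState]
      rw [h2] at hcase
      nlinarith
    have hLJ : 0 < L * J := by linarith
    have hL : 0 < (L : ℝ) := by
      rcases (Nat.cast_nonneg L : (0 : ℝ) ≤ L).eq_or_lt with h | h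
      · rw [← h, zero_mul] at hLJ
        exact absurd hLJ (lt_irrefl _)
      · exact h
    have hL1 : (1 : ℝ) ≤ L := by exact_mod_cast hL
    -- The total time for which `exp (-βΔ/4)` equals `ηε/12` exactly.
    set β := 4 / Δ * (Real.log 12 + l) with hβ
    have hlog12 : 0 ≤ Real.log 12 := Real.log_nonneg (by norm_num)
    have hβ0 : 0 < β := by positivity
    have hβΔ : β * Δ / 4 = Real.log 12 + l := by
      rw [hβ]
      field_simp
    have hX1 : 1 ≤ β * (L * J) := by
      nlinarith
    have hXle : β * (L * J) ≤ 24 * (L * J * l / Δ) := by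
      have h1 : β ≤ 24 * l / Δ := by
        rw [hβ, div_mul_eq_mul_div, div_le_div_iff_of_pos_right hΔ]
        linarith [log_twelve_le]
      calc β * (L * J) ≤ 24 * l / Δ * (L * J) := mul_le_mul_of_nonneg_right h1 hLJ.le
        _ = _ := by ring
    obtain ⟨N, hN0, hN2, hNstep, hNle⟩ := exists_step_count hX1 hω hω1
    have hN0' : (0 : ℝ) < N := by exact_mod_cast hN0
    have hx : β / N * (L * J) = β * (L * J) / N := by ring
    have hxle : β / N * (L * J) ≤ 1 / 2 := by
      rw [hx, div_le_iff₀ hN0']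
      linarith
    obtain ⟨m, d, B, hcard, hconn, htv⟩ := QubitMatrix.exists_dbm_of_step (t := β / N) hloc hsto
      (by positivity) hJ0 hJ hxle
      ((mul_le_mul_of_nonneg_left (le_mul_of_one_le_left hJ0 hL1) (by positivity)).trans hxle)
      hgap hη hε hε1 N
      (by
        have h1 : (N : ℝ) * (β / N) * Δ / 4 = Real.log 12 + l := by
          rw [mul_div_cancel₀ _ hN0'.ne', hβΔ]
        rw [h1, neg_add, Real.exp_add, Real.exp_neg, Real.exp_log (by norm_num), hldef,
          Real.log_inv, neg_neg, Real.exp_log hω]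
        exact le_of_eq (by ring))
      (by rw [hx]; exact hNstep)
    refine ⟨m, d, B, htv, ?_, hconn⟩
    have hk : ((2 ^ (2 * k) + k : ℕ) : ℝ) ≤ 2 * 2 ^ (2 * k) := by
      have : 2 * k < 2 ^ (2 * k) := Nat.lt_two_pow_self
      have h2 : 2 ^ (2 * k) + k ≤ 2 * 2 ^ (2 * k) := by omega
      exact_mod_cast h2
    have hY : (N : ℝ) ≤
        5 * ((24 * (L * J * l / Δ)) ^ (3 / 2 : ℝ) * (η * ε) ^ (-(1 / 2) : ℝ)) :=
      hNle.trans (mul_le_mul_of_nonneg_left (mul_le_mul_of_nonneg_right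
        (Real.rpow_le_rpow (by positivity) hXle (by norm_num)) (by positivity)) (by norm_num))
    calc ((m + d : ℕ) : ℝ) ≤ ((2 * (N * (2 * L * (2 ^ (2 * k) + k))) : ℕ) : ℝ) := by
          exact_mod_cast hcard
      _ = 4 * (L * N) * ((2 ^ (2 * k) + k : ℕ) : ℝ) := by
          push_cast
          ring
      _ ≤ 4 * (L * (5 * ((24 * (L * J * l / Δ)) ^ (3 / 2 : ℝ) * (η * ε) ^ (-(1 / 2) : ℝ)))) *
          (2 * 2 ^ (2 * k)) := by
          gcongr
      _ = 40 * 2 ^ (2 * k) *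
          (L * ((24 * (L * J * l / Δ)) ^ (3 / 2 : ℝ) * (η * ε) ^ (-(1 / 2) : ℝ))) := by
          ring
      _ = _ := by
          rw [step_bound_eq hL hJ0 hΔ (by linarith) hη hε]
          ring
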